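/- Let $N\ge 1$ and let $(\rho_n)_{n\in\mathbb N}$ be radial functions on $\mathbb R^N$ with $\rho_n\ge 0$, $\int_{\mathbb R^N}\rho_n(x)\,dx=1$ for all $n$, and $\lim_{n\to\infty}\int_{|x|>\gamma}\rho_n(x)\,dx=0$ for every $\gamma>0$. For $\varphi\in C_c^\infty(\mathbb R^N)$ define the matrix-valued function $$H_n\varphi(x)=\frac{N(N+2)}{2}\int_{\mathbb R^N}\frac{\varphi(x+h)-2\varphi(x)+\varphi(x-h)}{|h|^2}\,\frac{h\otimes h-\frac{|h|^2}{N+2}I_N}{|h|^2}\,\rho_n(h)\,dh .$$ For $u\in L^p(\mathbb R^N)$, $1\le p<\infty$, define the distributional non-local Hessian $\mathfrak H_nu=(\mathfrak H_n^{ij}u)_{i,j=1}^N$ by $$\langle \mathfrak H_n^{ij}u,\varphi\rangle=\int_{\mathbb R^N}u\,H_n^{ij}\varphi\,dx,\qquad \varphi\in C_c^\infty(\mathbb R^N).$$ If the distribution $\mathfrak H_nu$ is a locally integrable function, $\int_{\mathbb R^N}|\mathfrak H_nu(x)|^p\,dx\in[0,\infty]$ denotes the integral of the $p$-th power of its Frobenius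 norm; otherwise this quantity is $+\infty$. Let $W^{2,p}(\mathbb R^N)$ be the usual Sobolev space, and let $\mathrm{BV}^2(\mathbb R^N)$ be the space of $u\in W^{1,1}(\mathbb R^N)$ with $\nabla u\in \mathrm{BV}(\mathbb R^N,\mathbb R^N)$, i.e. whose second order distributional derivatives are finite signed Radon measures. (i) Let $u\in L^p(\mathbb R^N)$ for some $1<p<\infty$. Then $$u\in W^{2,p}(\mathbb R^N)\iff \liminf_{n\to\infty}\int_{\mathbb R^N}|\mathfrak H_nu(x)|^p\,dx<\infty .$$ (ii) Let $u\in L^1(\mathbb R^N)$. Then $$u\in \mathrm{BV}^2(\mathbb R^N)\iff \liminf_{n\to\infty}\int_{\mathbb R^N}|\mathfrak H_nu(x)|\,dx<\infty .$$ -/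

import Mathlib

open MeasureTheory Filter Topology
open scoped ENNReal ContDiff

noncomputable section

namespace NonlocalHessian

/-- `ℝ^N` with its Euclidean norm and Lebesgue measure. -/
abbrev E (N : ℕ) : Type := EuclideanSpace ℝ (Fin N)

/-- A smooth compactly supported real-valued function, i.e. an element of `C_c^∞(ℝ^N)`. -/
def IsTest {N : ℕ} (φ : E N → ℝ) : Prop :=
  ContDiff ℝ ∞ φ ∧ HasCompactSupport φ

/-- The classical partial derivative `∂φ/∂x_i`. -/
def pderiv {N : ℕ} (i : Fin N) (φ : E N → ℝ) (x : E N) : ℝ :=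
  fderiv ℝ φ x (EuclideanSpace.single i 1)

/-- `v` is the weak partial derivative `∂u/∂x_i` on `ℝ^N`. -/
def HasWeakPartial {N : ℕ} (i : Fin N) (u v : E N → ℝ) : Prop :=
  LocallyIntegrable u volume ∧ LocallyIntegrable v volume ∧
    ∀ φ : E N → ℝ, IsTest φ → ∫ x, u x * pderiv i φ x = -∫ x, v x * φ x

/-- `u ∈ W^{k,p}(ℝ^N)`: `W^{0,p} = L^p`, and `u ∈ W^{k+1,p}` when `u ∈ L^p` and each first order
partial derivative exists weakly and belongs to `W^{k,p}`. -/
def MemW {N : ℕ} : ℕ → ℝ≥0∞ → (E N → ℝ) → Prop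
  | 0, p, u => MemLp u p volume
  | k + 1, p, u => MemLp u p volume ∧ ∀ i, ∃ v, HasWeakPartial i u v ∧ MemW k p v

/-- The integral of `φ` with respect to the finite signed measure `μ`. -/
def signedIntegral {N : ℕ} (φ : E N → ℝ) (μ : SignedMeasure (E N)) : ℝ :=
  (∫ x, φ x ∂μ.toJordanDecomposition.posPart) - ∫ x, φ x ∂μ.toJordanDecomposition.negPart

/-- `w ∈ BV(ℝ^N)`: `w ∈ L^1`, and each distributional partial derivative of `w` is represented by a
finite (signed) Radon measure on `ℝ^N`. -/
def MemBV {N : ℕ} (w : E N → ℝ) : Prop :=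
  MemLp w 1 volume ∧ ∀ i, ∃ μ : SignedMeasure (E N),
    ∀ φ : E N → ℝ, IsTest φ → ∫ x, w x * pderiv i φ x = -signedIntegral φ μ

/-- `u ∈ BV²(ℝ^N)`: `u ∈ W^{1,1}(ℝ^N)` and all components of `∇u` are in `BV(ℝ^N)`. -/
def MemBV2 {N : ℕ} (u : E N → ℝ) : Prop :=
  MemW 1 1 u ∧ ∀ i, ∃ g, HasWeakPartial i u g ∧ MemBV g

/-- The assumptions on the sequence of kernels `ρ_n`: radial, nonnegative, of integral one, and
concentrating at the origin. (A Bochner integral equal to `1` forces `ρ_n` to be integrable.) -/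
structure IsRadialMollifierSeq {N : ℕ} (ρ : ℕ → E N → ℝ) : Prop where
  radial : ∀ n x y, ‖x‖ = ‖y‖ → ρ n x = ρ n y
  nonneg : ∀ n x, 0 ≤ ρ n x
  integral_eq_one : ∀ n, ∫ x, ρ n x = 1
  tendsto_tail : ∀ γ : ℝ, 0 < γ → Tendsto (fun n => ∫ x in {x | γ < ‖x‖}, ρ n x) atTop (𝓝 0)

/-- The non-local Hessian `H u (x)` with kernel `ρ`, as a Lebesgue integral, componentwise. -/
def nlHessian {N : ℕ} (ρ : E N → ℝ) (u : E N → ℝ) (x : E N) : Matrix (Fin N) (Fin N) ℝ :=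
  fun i j => (N * (N + 2) / 2 : ℝ) *
    ∫ h, (u (x + h) - 2 * u x + u (x - h)) / ‖h‖ ^ 2 *
      ((h i * h j - ‖h‖ ^ 2 / (N + 2) * (1 : Matrix (Fin N) (Fin N) ℝ) i j) / ‖h‖ ^ 2) * ρ h

/-- The distributional non-local Hessian of `u`: its `(i,j)` component maps a test function `φ` to
`∫ u H^{ij} φ`. -/
def distNlHessian {N : ℕ} (ρ : E N → ℝ) (u : E N → ℝ) (i j : Fin N) (φ : E N → ℝ) : ℝ :=
  ∫ x, u x * nlHessian ρ φ x i j

/-- The distributional non-local Hessian of `u` is the locally integrable matrix field `v`. -/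
def IsDistNlHessian {N : ℕ} (ρ : E N → ℝ) (u : E N → ℝ)
    (v : E N → Matrix (Fin N) (Fin N) ℝ) : Prop :=
  ∀ i j, LocallyIntegrable (fun x => v x i j) volume ∧
    ∀ φ : E N → ℝ, IsTest φ → distNlHessian ρ u i j φ = ∫ x, v x i j * φ x

/-- The Frobenius norm of a matrix. -/
def frob {N : ℕ} (A : Matrix (Fin N) (Fin N) ℝ) : ℝ :=
  Real.sqrt (∑ i, ∑ j, A i j ^ 2)

/-- `∫ |𝔥u(x)|^p dx ∈ [0,∞]`, where `𝔥u` is the distributional non-local Hessian: if `𝔥u` is a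
locally integrable function (which is then unique almost everywhere, so that the infimum is over
equal values) this is the integral of the `p`-th power of its Frobenius norm; if `𝔥u` is not a
function, it is `∞` (the infimum of the empty family). -/
def nlEnergy {N : ℕ} (ρ : E N → ℝ) (p : ℝ) (u : E N → ℝ) : ℝ≥0∞ :=
  ⨅ (v : E N → Matrix (Fin N) (Fin N) ℝ) (_ : IsDistNlHessian ρ u v),
    ∫⁻ x, ENNReal.ofReal (frob (v x) ^ p)

/-- The function representing the distributional non-local Hessian is unique a.e. -/
theorem IsDistNlHessian.ae_eq {N : ℕ} {ρ : E N → ℝ} {u : E N → ℝ}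
    {v w : E N → Matrix (Fin N) (Fin N) ℝ}
    (hv : IsDistNlHessian ρ u v) (hw : IsDistNlHessian ρ u w) : v =ᵐ[volume] w := by
  have h : ∀ i j, ∀ᵐ x ∂(volume : Measure (E N)), v x i j = w x i j := by
    intro i j
    refine ae_eq_of_integral_contDiff_smul_eq (hv i j).1 (hw i j).1 ?_
    intro φ h1 h2
    have e := ((hv i j).2 φ ⟨h1, h2⟩).symm.trans ((hw i j).2 φ ⟨h1, h2⟩)
    simpa [smul_eq_mul, mul_comm] using e
  have h' : ∀ᵐ x ∂(volume : Measure (E N)), ∀ i j, v x i j = w x i j := by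
    simpa only [ae_all_iff] using h
  filter_upwards [h'] with x hx
  ext i j
  exact hx i j

/-- If `v` is the distributional non-local Hessian of `u`, then `nlEnergy` is the integral of the
`p`-th power of the Frobenius norm of `v`. -/
theorem nlEnergy_eq {N : ℕ} {ρ : E N → ℝ} {u : E N → ℝ} (p : ℝ)
    {v : E N → Matrix (Fin N) (Fin N) ℝ} (hv : IsDistNlHessian ρ u v) :
    nlEnergy ρ p u = ∫⁻ x, ENNReal.ofReal (frob (v x) ^ p) := by
  refine le_antisymm (iInf₂_le v hv) (le_iInf₂ fun w hw => le_of_eq (lintegral_congr_ae ?_))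
  filter_upwards [hv.ae_eq hw] with x hx
  rw [hx]

end NonlocalHessian

end

/-! Both parts pass through one intermediate condition, `HessBound u q C`: the distributional second
derivatives of `u` are bounded on test functions by the norm of the dual exponent `q` (with `q = ∞`
when `p = 1`). The tool throughout is the correlation `corr u φ y = ∫ u(x) φ(x + y) dx`. It is
smooth even though `u` is only in `L^p`, its derivatives fall on `φ`, and its second derivatives at
`0` are the distributional second derivatives of `u` tested on `φ`. By Fubini, `⟨𝔥_n u, φ⟩` is the
non-local Hessian of `corr u φ` at the single point `0` (`distNlHessian_eq`), so statements about
rough `u` become Taylor expansions of a smooth function.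

Sobolev or BV² regularity implies finite energy. Integrating by parts twice gives `HessBound`. It
bounds the second derivatives of `corr u φ` uniformly, so Taylor and the converse of Hölder's
inequality give a bound of order `|h|²` for the `L^p` norm of the second difference of `u`.
Averaging over the probability density `ρ_n` (Jensen and Tonelli) bounds the pointwise non-local
Hessian in `L^p` uniformly in `n`, and Fubini shows that it represents the distribution `𝔥_n u`.

Finite liminf implies regularity. Reflections and polarization determine the fourth moments of a
radial kernel, and these show that the non-local Hessian of a quadratic form is exactly its Hessian.
The Taylor remainder vanishes as the kernels concentrate, so the non-local Hessians of `corr u φ` at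
`0` converge to its Hessian (`tendsto_nlHessian_zero`). Along an ultrafilter on which the energies
stay bounded, the pairings of `𝔥_n u` with `φ` therefore converge to `∫ u ∂_i∂_j φ`, and Hölder
gives `HessBound`. The bound makes the difference quotients of `u` Cauchy in `L^p`, also for `p =
1`, which produces the gradient. The second derivatives are weak limits of `𝔥_n u`: the Riesz–Markov
theorem gives measures, finite when `p = 1` and with `L^p` densities when `1 < p < ∞`. -/

namespace NonlocalHessian

/-! ### Second differences, correlations and test functions -/

variable {N : ℕ}

/-- The symmetric second difference of `f` at `x` with increment `h`. -/
def secondDiff (f : E N → ℝ) (h x : E N) : ℝ :=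
  f (x + h) - 2 * f x + f (x - h)

/-- The correlation `y ↦ ∫ u(x) φ(x + y) dx`. -/
noncomputable def corr (u φ : E N → ℝ) (y : E N) : ℝ :=
  ∫ x, u x * φ (x + y)

theorem IsTest.pderiv {φ : E N → ℝ} (hφ : IsTest φ) (i : Fin N) : IsTest (pderiv i φ) := by
  refine ⟨?_, ?_⟩
  · exact (hφ.1.fderiv_right (m := ∞) (by simp)).clm_apply contDiff_const
  · exact (hφ.2.fderiv_apply (𝕜 := ℝ) (EuclideanSpace.single i 1))

theorem IsTest.continuous {φ : E N → ℝ} (hφ : IsTest φ) : Continuous φ := hφ.1.continuous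

theorem IsTest.memLp {φ : E N → ℝ} (hφ : IsTest φ) (q : ℝ≥0∞) : MemLp φ q volume :=
  hφ.continuous.memLp_of_hasCompactSupport hφ.2

theorem IsTest.comp_add_right {φ : E N → ℝ} (hφ : IsTest φ) (y : E N) :
    IsTest (fun x => φ (x + y)) :=
  ⟨hφ.1.comp (contDiff_id.add contDiff_const),
    hφ.2.comp_homeomorph (Homeomorph.addRight y)⟩

theorem pderiv_comp_add_right (i : Fin N) (φ : E N → ℝ) (y : E N) :
    pderiv i (fun x => φ (x + y)) = fun x => pderiv i φ (x + y) := by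
  funext x
  simp only [pderiv, fderiv_comp_add_right]

/-- Reflecting `u` turns the correlation into a convolution, so smoothness and differentiation under
the integral come from the theory of convolutions. -/
theorem corr_eq_convolution (u φ : E N → ℝ) :
    corr u φ = convolution (fun x => u (-x)) φ (ContinuousLinearMap.mul ℝ ℝ) volume := by
  funext y
  rw [convolution, ← integral_neg_eq_self, corr]
  simp [add_comm]

theorem locallyIntegrable_comp_neg {u : E N → ℝ} (hu : LocallyIntegrable u volume) :
    LocallyIntegrable (fun x => u (-x)) volume := by
  rw [locallyIntegrable_iff] at hu ⊢
  intro K hK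
  have e := (Measure.measurePreserving_neg (volume : Measure (E N))).integrableOn_comp_preimage
    (MeasurableEquiv.neg (E N)).measurableEmbedding (f := u) (s := -K)
  have := e.2 (hu _ hK.neg)
  simpa [Function.comp_def] using this

theorem corr_contDiff {u φ : E N → ℝ} (hu : LocallyIntegrable u volume) (hφ : IsTest φ) :
    ContDiff ℝ ∞ (corr u φ) := by
  rw [corr_eq_convolution]
  exact hφ.2.contDiff_convolution_right _ (locallyIntegrable_comp_neg hu) hφ.1

/-- All derivatives fall on the test function. Applied twice and evaluated at `0`, this identifies
the Hessian of the correlation with the distributional Hessian of `u`. -/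
theorem pderiv_corr {u φ : E N → ℝ} (hu : LocallyIntegrable u volume) (hφ : IsTest φ)
    (i : Fin N) : pderiv i (corr u φ) = corr u (pderiv i φ) := by
  funext y
  rw [corr_eq_convolution, corr_eq_convolution, pderiv,
    (hφ.2.hasFDerivAt_convolution_right (ContinuousLinearMap.mul ℝ ℝ) (locallyIntegrable_comp_neg hu)
      (hφ.1.of_le (by simp)) y).fderiv,
    convolution_precompR_apply _ (locallyIntegrable_comp_neg hu) (hφ.2.fderiv ℝ) (hφ.1.continuous_fderiv (by simp))]
  rfl

theorem corr_zero (u φ : E N → ℝ) : corr u φ 0 = ∫ x, u x * φ x := by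
  simp [corr]

theorem memLp_comp_add_right {u : E N → ℝ} {p : ℝ≥0∞} (hu : MemLp u p volume) (y : E N) :
    MemLp (fun x => u (x + y)) p volume :=
  hu.comp_measurePreserving (measurePreserving_add_right volume y)

theorem eLpNorm_comp_add_right {u : E N → ℝ} {p : ℝ≥0∞} (hu : AEStronglyMeasurable u volume)
    (y : E N) : eLpNorm (fun x => u (x + y)) p volume = eLpNorm u p volume :=
  eLpNorm_comp_measurePreserving hu (measurePreserving_add_right volume y)

/-! ### Hölder's inequality for real pairings -/

section Holder

variable {α : Type*} [MeasurableSpace α] {μ : Measure α}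

theorem integrable_mul_of_holderConjugate {f g : α → ℝ} {p q : ℝ≥0∞} [p.HolderConjugate q]
    (hf : MemLp f p μ) (hg : MemLp g q μ) : Integrable (fun x => f x * g x) μ :=
  hf.integrable_mul hg

theorem integral_abs_mul_le {f g : α → ℝ} {p q : ℝ≥0∞} [p.HolderConjugate q]
    (hf : MemLp f p μ) (hg : MemLp g q μ) :
    ∫ x, |f x * g x| ∂μ ≤ (eLpNorm f p μ).toReal * (eLpNorm g q μ).toReal := by
  have h := eLpNorm_smul_le_mul_eLpNorm (r := 1) hg.1 hf.1 (p := p) (q := q)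
  have h1 : ∫ x, |f x * g x| ∂μ = (eLpNorm (f • g) 1 μ).toReal := by
    have hm : AEStronglyMeasurable (fun x => |f x * g x|) μ := (hf.1.mul hg.1).norm
    rw [eLpNorm_one_eq_lintegral_enorm, integral_eq_lintegral_of_nonneg_ae
      (ae_of_all _ fun x => abs_nonneg _) hm]
    congr 1
    refine lintegral_congr fun x => ?_
    simp only [Pi.smul_apply', smul_eq_mul, Real.enorm_eq_ofReal_abs]
  rw [h1, ← ENNReal.toReal_mul]
  exact ENNReal.toReal_mono (ENNReal.mul_ne_top hf.2.ne hg.2.ne) h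

theorem abs_integral_mul_le {f g : α → ℝ} {p q : ℝ≥0∞} [p.HolderConjugate q]
    (hf : MemLp f p μ) (hg : MemLp g q μ) :
    |∫ x, f x * g x ∂μ| ≤ (eLpNorm f p μ).toReal * (eLpNorm g q μ).toReal :=
  (abs_integral_le_integral_abs).trans (integral_abs_mul_le hf hg)

end Holder

/-! ### Taylor estimates -/

/-- The mean value inequality is used twice, first for `f' - a s` and then for the remainder itself.
The reference value `a` is free: `a = 0` turns bounded second derivatives into growth bounds, and `a
= f'' 0` gives the consistency estimate. The lost factor `1/2` is harmless. -/
theorem abs_taylor_one_le {f f' f'' : ℝ → ℝ} {a M : ℝ} (hf : ∀ t, HasDerivAt f (f' t) t)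
    (hf' : ∀ t, HasDerivAt f' (f'' t) t) (hM : ∀ t, |t| ≤ 1 → |f'' t - a| ≤ M)
    {t : ℝ} (ht : |t| ≤ 1) : |f t - f 0 - f' 0 * t - a * t ^ 2 / 2| ≤ M := by
  have hconv : Convex ℝ (Set.Icc (-1 : ℝ) 1) := convex_Icc _ _
  have h0 : (0 : ℝ) ∈ Set.Icc (-1 : ℝ) 1 := by constructor <;> norm_num
  have M0 : 0 ≤ M := (abs_nonneg _).trans (hM 0 (by simp))
  have h1 : ∀ s ∈ Set.Icc (-1 : ℝ) 1, ‖f' s - f' 0 - a * s‖ ≤ M := by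
    intro s hs
    have := hconv.norm_image_sub_le_of_norm_hasDerivWithin_le
      (f := fun s => f' s - a * s) (f' := fun s => f'' s - a) (C := M)
      (fun x hx => ((hf' x).sub (by simpa using (hasDerivAt_id x).const_mul a)).hasDerivWithinAt)
      (fun x hx => hM x (abs_le.2 hx)) h0 hs
    have e : f' s - a * s - (f' 0 - a * 0) = f' s - f' 0 - a * s := by ring
    rw [e] at this
    refine this.trans ?_
    have : ‖s - 0‖ ≤ 1 := by simpa using abs_le.2 hs
    nlinarith
  have h2 := hconv.norm_image_sub_le_of_norm_hasDerivWithin_le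
      (f := fun s => f s - f' 0 * s - a * s ^ 2 / 2) (f' := fun s => f' s - f' 0 - a * s) (C := M)
      (x := 0) (y := t) (fun x hx => by
        refine HasDerivAt.hasDerivWithinAt ?_
        have h3 : HasDerivAt (fun s : ℝ => a * s ^ 2 / 2) (a * x) x := by
          have := ((hasDerivAt_pow 2 x).const_mul a).div_const 2
          exact this.congr_deriv (by norm_num; ring)
        exact ((hf x).sub (by simpa using (hasDerivAt_id x).const_mul (f' 0))).sub h3)
      h1 h0 (abs_le.1 ht)
  have e : f t - f' 0 * t - a * t ^ 2 / 2 - (f 0 - f' 0 * 0 - a * 0 ^ 2 / 2)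
    = f t - f 0 - f' 0 * t - a * t ^ 2 / 2 := by ring
  rw [e] at h2
  refine h2.trans ?_
  have : ‖t - 0‖ ≤ 1 := by simpa using ht
  nlinarith

/-- The first order terms at `1` and `-1` cancel, and the two quadratic terms add up to `a`. -/
theorem abs_secondDiff_one_le {f f' f'' : ℝ → ℝ} {a M : ℝ} (hf : ∀ t, HasDerivAt f (f' t) t)
    (hf' : ∀ t, HasDerivAt f' (f'' t) t) (hM : ∀ t, |t| ≤ 1 → |f'' t - a| ≤ M) :
    |f 1 - 2 * f 0 + f (-1) - a| ≤ 2 * M := by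
  have h1 := abs_le.1 (abs_taylor_one_le hf hf' hM (t := 1) (by simp))
  have h2 := abs_le.1 (abs_taylor_one_le hf hf' hM (t := -1) (by simp))
  rw [abs_le]
  constructor <;> linarith [h1.1, h1.2, h2.1, h2.2]

theorem pderiv_contDiff {Φ : E N → ℝ} (hΦ : ContDiff ℝ ∞ Φ) (i : Fin N) :
    ContDiff ℝ ∞ (pderiv i Φ) :=
  (hΦ.fderiv_right (m := ∞) (by simp)).clm_apply contDiff_const

theorem fderiv_eq_sum_pderiv (Φ : E N → ℝ) (x h : E N) :
    fderiv ℝ Φ x h = ∑ k, h k * pderiv k Φ x := by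
  have e : h = ∑ k, h k • EuclideanSpace.single k (1 : ℝ) := by
    have := (EuclideanSpace.basisFun (Fin N) ℝ).sum_repr h
    simpa using this.symm
  conv_lhs => rw [e]
  simp [pderiv, map_sum]

theorem hasDerivAt_line {Φ : E N → ℝ} (hΦ : ContDiff ℝ ∞ Φ) (h : E N) (t : ℝ) :
    HasDerivAt (fun t : ℝ => Φ (t • h)) (∑ k, h k * pderiv k Φ (t • h)) t := by
  rw [← fderiv_eq_sum_pderiv]
  have h1 : HasDerivAt (fun t : ℝ => t • h) h t := by
    simpa using (hasDerivAt_id t).smul_const h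
  exact ((hΦ.differentiable (by simp)) (t • h)).hasFDerivAt.comp_hasDerivAt t h1

theorem hasDerivAt_line_two {Φ : E N → ℝ} (hΦ : ContDiff ℝ ∞ Φ) (h : E N) (t : ℝ) :
    HasDerivAt (fun t : ℝ => ∑ k, h k * pderiv k Φ (t • h))
      (∑ k, ∑ l, h k * h l * pderiv l (pderiv k Φ) (t • h)) t := by
  refine HasDerivAt.fun_sum fun k _ => ?_
  have := (hasDerivAt_line (pderiv_contDiff hΦ k) h t).const_mul (h k)
  simpa [Finset.mul_sum, mul_assoc] using this

theorem abs_sum_sum_mul_le (h : E N) {a : Fin N → Fin N → ℝ} {M : ℝ}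
    (ha : ∀ k l, |a k l| ≤ M) :
    |∑ k, ∑ l, h k * h l * a k l| ≤ N ^ 2 * M * ‖h‖ ^ 2 := by
  have hk : ∀ k, |h k| ≤ ‖h‖ := fun k => by simpa using PiLp.norm_apply_le h k
  have h1 : ∀ k l, |h k * h l * a k l| ≤ ‖h‖ ^ 2 * M := by
    intro k l
    rw [abs_mul, abs_mul, sq]
    have := hk k
    have := hk l
    have := ha k l
    gcongr
  calc |∑ k, ∑ l, h k * h l * a k l| ≤ ∑ k, ∑ l, |h k * h l * a k l| :=
        (Finset.abs_sum_le_sum_abs _ _).trans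
          (Finset.sum_le_sum fun k _ => Finset.abs_sum_le_sum_abs _ _)
    _ ≤ ∑ k : Fin N, ∑ l : Fin N, ‖h‖ ^ 2 * M :=
        Finset.sum_le_sum fun k _ => Finset.sum_le_sum fun l _ => h1 k l
    _ = N ^ 2 * M * ‖h‖ ^ 2 := by simp; ring

/-- One-dimensional Taylor along the segment from `-h` to `h`, with the Hessian compared to a frozen
matrix `a`. -/
theorem abs_secondDiff_sub_le {Φ : E N → ℝ} (hΦ : ContDiff ℝ ∞ Φ) {h : E N}
    {a : Fin N → Fin N → ℝ} {M : ℝ}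
    (hM : ∀ k l, ∀ y : E N, ‖y‖ ≤ ‖h‖ → |pderiv l (pderiv k Φ) y - a k l| ≤ M) :
    |secondDiff Φ h 0 - ∑ k, ∑ l, h k * h l * a k l| ≤ 2 * (N ^ 2 * M * ‖h‖ ^ 2) := by
  have := abs_secondDiff_one_le (fun t => hasDerivAt_line hΦ h t)
    (fun t => hasDerivAt_line_two hΦ h t) (a := ∑ k, ∑ l, h k * h l * a k l)
    (M := N ^ 2 * M * ‖h‖ ^ 2) (fun t ht => by
      have e : (∑ k, ∑ l, h k * h l * pderiv l (pderiv k Φ) (t • h))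
          - ∑ k, ∑ l, h k * h l * a k l
          = ∑ k, ∑ l, h k * h l * (pderiv l (pderiv k Φ) (t • h) - a k l) := by
        simp only [mul_sub, Finset.sum_sub_distrib]
      rw [e]
      refine abs_sum_sum_mul_le h fun k l => hM k l _ ?_
      rw [norm_smul]
      exact mul_le_of_le_one_left (norm_nonneg _) ht)
  simpa [secondDiff] using this

theorem abs_secondDiff_le {Φ : E N → ℝ} (hΦ : ContDiff ℝ ∞ Φ) {M : ℝ}
    (hM : ∀ k l, ∀ y : E N, |pderiv l (pderiv k Φ) y| ≤ M) (h : E N) :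
    |secondDiff Φ h 0| ≤ 2 * N ^ 2 * M * ‖h‖ ^ 2 := by
  have := abs_secondDiff_sub_le hΦ (h := h) (a := fun _ _ => 0) (M := M)
    (fun k l y _ => by simpa using hM k l y)
  simp only [mul_zero, Finset.sum_const_zero, sub_zero] at this
  linarith

/-- First order expansion along a coordinate axis; its quadratic error gives the rate of convergence
of difference quotients. -/
theorem abs_sub_sub_pderiv_le {Φ : E N → ℝ} (hΦ : ContDiff ℝ ∞ Φ) {M : ℝ} (i : Fin N)
    (hM : ∀ y : E N, |pderiv i (pderiv i Φ) y| ≤ M) (t : ℝ) :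
    |Φ (t • EuclideanSpace.single i 1) - Φ 0 - t * pderiv i Φ 0| ≤ t ^ 2 * M := by
  have hs : ∀ (Ψ : E N → ℝ), ContDiff ℝ ∞ Ψ → ∀ s : ℝ,
      HasDerivAt (fun s : ℝ => Ψ (s • t • EuclideanSpace.single i 1))
        (t * pderiv i Ψ (s • t • EuclideanSpace.single i 1)) s := by
    intro Ψ hΨ s
    have := hasDerivAt_line hΨ (t • EuclideanSpace.single i 1) s
    exact this.congr_deriv (by simp)
  have := abs_taylor_one_le (fun s => hs Φ hΦ s)
    (fun s => (hs _ (pderiv_contDiff hΦ i) s).const_mul t) (a := 0) (M := t ^ 2 * M)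
    (fun s _ => by
      rw [sub_zero, ← mul_assoc, abs_mul, ← sq, abs_of_nonneg (sq_nonneg t)]
      exact mul_le_mul_of_nonneg_left (hM _) (sq_nonneg t)) (t := 1) (by simp)
  simpa using this

/-! ### Moments of radial kernels -/

theorem integrable_mul_of_bound {ρ f : E N → ℝ} (hρ : Integrable ρ volume)
    (hf : AEStronglyMeasurable f volume) {B : ℝ} (hB : ∀ h, |f h| ≤ B) :
    Integrable (fun h => f h * ρ h) volume :=
  hρ.bdd_mul hf (ae_of_all _ hB)

/-- The weighted quartic moment of a radial kernel. -/
noncomputable def quartic (ρ : E N → ℝ) (a b c d : E N) : ℝ :=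
  ∫ h, inner ℝ h a * inner ℝ h b * inner ℝ h c * inner ℝ h d / ‖h‖ ^ 4 * ρ h

theorem integrable_quartic {ρ : E N → ℝ} (hρ : Integrable ρ volume) (a b c d : E N) :
    Integrable (fun h => inner ℝ h a * inner ℝ h b * inner ℝ h c * inner ℝ h d / ‖h‖ ^ 4 * ρ h)
      volume := by
  refine integrable_mul_of_bound hρ (B := ‖a‖ * ‖b‖ * ‖c‖ * ‖d‖) ?_ fun h => ?_
  · exact Measurable.aestronglyMeasurable (by fun_prop)
  · have ha := abs_real_inner_le_norm h a
    have hb := abs_real_inner_le_norm h b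
    have hc := abs_real_inner_le_norm h c
    have hd := abs_real_inner_le_norm h d
    rcases eq_or_ne h 0 with rfl | h0
    · simp; positivity
    · have hn : 0 < ‖h‖ := norm_pos_iff.2 h0
      rw [abs_div, abs_mul, abs_mul, abs_mul, abs_of_nonneg (by positivity : 0 ≤ ‖h‖ ^ 4),
        div_le_iff₀ (by positivity)]
      calc _ ≤ (‖h‖ * ‖a‖) * (‖h‖ * ‖b‖) * (‖h‖ * ‖c‖) * (‖h‖ * ‖d‖) := by gcongr
        _ = _ := by ring

/-- The reflection in the hyperplane orthogonal to `v - w` maps `v` to `w` and preserves Lebesgue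
measure, norms and the radial weight. -/
theorem quartic_self_eq_of_norm_eq {ρ : E N → ℝ} (hr : ∀ x y, ‖x‖ = ‖y‖ → ρ x = ρ y) {v w : E N}
    (hvw : ‖v‖ = ‖w‖) : quartic ρ v v v v = quartic ρ w w w w := by
  set T := Submodule.reflection (Submodule.span ℝ {v - w})ᗮ with hT
  have hTv : T v = w := Submodule.reflection_sub hvw
  have := T.measurePreserving.integral_comp T.toHomeomorph.measurableEmbedding
    (fun h => inner ℝ h w * inner ℝ h w * inner ℝ h w * inner ℝ h w / ‖h‖ ^ 4 * ρ h)
  rw [quartic, quartic, ← this]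
  congr 1
  funext h
  simp only [← hTv, LinearIsometryEquiv.inner_map_map, LinearIsometryEquiv.norm_map]
  rw [hr (T h) h (T.norm_map h)]

theorem quartic_self_eq {ρ : E N → ℝ} (hr : ∀ x y, ‖x‖ = ‖y‖ → ρ x = ρ y) {e : E N}
    (he : ‖e‖ = 1) (v : E N) : quartic ρ v v v v = quartic ρ e e e e * (inner ℝ v v) ^ 2 := by
  have h1 : quartic ρ v v v v = quartic ρ (‖v‖ • e) (‖v‖ • e) (‖v‖ • e) (‖v‖ • e) :=
    quartic_self_eq_of_norm_eq hr (by simp [norm_smul, he])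
  rw [h1, quartic, quartic, ← integral_mul_const]
  congr 1
  funext h
  rw [inner_smul_right, real_inner_self_eq_norm_sq]
  ring

/-- A symmetric four-linear form is determined by its diagonal, which here is a multiple of `|v|⁴`
by rotation invariance and homogeneity. Polarization over three signs yields `8 · 4! = 192` copies
of the form, while the same signed sum of `|v|⁴` yields `64` times the sum over the three pairings.
-/
theorem quartic_eq {ρ : E N → ℝ} (hr : ∀ x y, ‖x‖ = ‖y‖ → ρ x = ρ y)
    (hρ : Integrable ρ volume) {e : E N} (he : ‖e‖ = 1) (a b c d : E N) :
    quartic ρ a b c d = quartic ρ e e e e / 3 * (inner ℝ a b * inner ℝ c d +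
      inner ℝ a c * inner ℝ b d + inner ℝ a d * inner ℝ b c) := by
  let σ : Bool → ℝ := fun t => if t then 1 else -1
  let w : Bool × Bool × Bool → E N := fun t => a + σ t.1 • b + σ t.2.1 • c + σ t.2.2 • d
  have h1 : 192 * quartic ρ a b c d
      = ∑ t : Bool × Bool × Bool, σ t.1 * σ t.2.1 * σ t.2.2 * quartic ρ (w t) (w t) (w t) (w t) := by
    simp only [quartic, ← integral_const_mul]
    rw [← integral_finsetSum _ fun t _ => (integrable_quartic hρ _ _ _ _).const_mul _]
    congr 1
    funext h
    simp only [Fintype.sum_prod_type, Fintype.sum_bool, w, σ, inner_add_right, inner_smul_right]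
    simp only [if_true, Bool.false_eq_true, if_false]
    ring
  have h2 : ∑ t : Bool × Bool × Bool, σ t.1 * σ t.2.1 * σ t.2.2 * quartic ρ (w t) (w t) (w t) (w t)
      = 64 * quartic ρ e e e e * (inner ℝ a b * inner ℝ c d +
      inner ℝ a c * inner ℝ b d + inner ℝ a d * inner ℝ b c) := by
    simp only [quartic_self_eq hr he (w _)]
    simp only [Fintype.sum_prod_type, Fintype.sum_bool, w, σ, inner_add_right, inner_smul_right,
      inner_add_left, inner_smul_left, real_inner_comm a, real_inner_comm b c,
      real_inner_comm b d, real_inner_comm c d, conj_trivial]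
    simp only [if_true, Bool.false_eq_true, if_false]
    rw [real_inner_comm b a, real_inner_comm c a, real_inner_comm d a, real_inner_comm c b,
      real_inner_comm d b, real_inner_comm d c]
    ring
  linarith

theorem inner_single (h : E N) (i : Fin N) : inner ℝ h (EuclideanSpace.single i 1) = h i := by
  simp [EuclideanSpace.inner_single_right]

theorem inner_single_single (i j : Fin N) :
    inner ℝ (EuclideanSpace.single i (1 : ℝ)) (EuclideanSpace.single j 1)
      = (1 : Matrix (Fin N) (Fin N) ℝ) i j := by
  rw [inner_single, Matrix.one_apply]
  simp [eq_comm]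

theorem sum_sq_eq (h : E N) : ∑ i, h i * h i = ‖h‖ ^ 2 := by
  rw [EuclideanSpace.real_norm_sq_eq]
  exact Finset.sum_congr rfl fun i _ => (sq _).symm

theorem ae_ne_zero (hN : 1 ≤ N) : ∀ᵐ h : E N ∂volume, h ≠ 0 := by
  have : Nonempty (Fin N) := ⟨⟨0, hN⟩⟩
  have : Nontrivial (E N) := inferInstance
  exact Measure.ae_ne volume 0

theorem integrable_of_integral_eq_one {ρ : E N → ℝ} (h1 : ∫ x, ρ x = 1) : Integrable ρ volume := by
  by_contra h
  rw [integral_undef h] at h1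
  exact zero_ne_one h1

/-- The quartic moments of a radial kernel of integral one, in coordinates. -/
theorem quartic_moment (hN : 1 ≤ N) {ρ : E N → ℝ} (hr : ∀ x y, ‖x‖ = ‖y‖ → ρ x = ρ y)
    (h1 : ∫ x, ρ x = 1) (i j k l : Fin N) :
    N * (N + 2) * ∫ h : E N, h i * h j * h k * h l / ‖h‖ ^ 4 * ρ h
      = (1 : Matrix (Fin N) (Fin N) ℝ) i j * (1 : Matrix (Fin N) (Fin N) ℝ) k l
        + (1 : Matrix (Fin N) (Fin N) ℝ) i k * (1 : Matrix (Fin N) (Fin N) ℝ) j l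
        + (1 : Matrix (Fin N) (Fin N) ℝ) i l * (1 : Matrix (Fin N) (Fin N) ℝ) j k := by
  have hρ := integrable_of_integral_eq_one h1
  set s : Fin N → E N := fun i => EuclideanSpace.single i 1 with hs
  have he : ‖s ⟨0, hN⟩‖ = 1 := by simp [hs]
  set κ := quartic ρ (s ⟨0, hN⟩) (s ⟨0, hN⟩) (s ⟨0, hN⟩) (s ⟨0, hN⟩) / 3 with hκ
  have hq : ∀ i j k l, quartic ρ (s i) (s j) (s k) (s l)
      = κ * ((1 : Matrix (Fin N) (Fin N) ℝ) i j * (1 : Matrix (Fin N) (Fin N) ℝ) k l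
        + (1 : Matrix (Fin N) (Fin N) ℝ) i k * (1 : Matrix (Fin N) (Fin N) ℝ) j l
        + (1 : Matrix (Fin N) (Fin N) ℝ) i l * (1 : Matrix (Fin N) (Fin N) ℝ) j k) := by
    intro i j k l
    rw [quartic_eq hr hρ he]
    simp only [hs, inner_single_single]
    rfl
  -- Normalization: since `∑ h_i² h_k² = |h|⁴`, this sum of moments is the total mass of `ρ`.
  have hsum : ∑ i, ∑ k, quartic ρ (s i) (s i) (s k) (s k) = 1 := by
    simp only [quartic]
    have e : ∀ i, ∑ k, ∫ h, inner ℝ h (s i) * inner ℝ h (s i) * inner ℝ h (s k) * inner ℝ h (s k)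
          / ‖h‖ ^ 4 * ρ h
        = ∫ h, ∑ k, inner ℝ h (s i) * inner ℝ h (s i) * inner ℝ h (s k) * inner ℝ h (s k)
          / ‖h‖ ^ 4 * ρ h :=
      fun i => (integral_finsetSum _ fun k _ => integrable_quartic hρ _ _ _ _).symm
    simp only [e]
    rw [← integral_finsetSum _ fun i _ =>
      integrable_finsetSum _ fun k _ => integrable_quartic hρ _ _ _ _, ← h1]
    refine integral_congr_ae ?_
    filter_upwards [ae_ne_zero hN] with h h0
    have hn : ‖h‖ ≠ 0 := norm_ne_zero_iff.2 h0
    have : ∀ i k, inner ℝ h (s i) * inner ℝ h (s i) * inner ℝ h (s k) * inner ℝ h (s k)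
          / ‖h‖ ^ 4 * ρ h = (h i * h i) * ((h k * h k) * (ρ h / ‖h‖ ^ 4)) := by
      intro i k
      simp only [hs, inner_single]
      ring
    simp only [this]
    simp only [← Finset.mul_sum, ← Finset.sum_mul, sum_sq_eq]
    field_simp
  -- Summing the pairings over `i` and `k` gives `N² + 2N`, hence `κ = 1 / (N (N + 2))`.
  have hκ1 : N * (N + 2) * κ = 1 := by
    simp only [hq] at hsum
    rw [← hsum]
    simp only [← Finset.mul_sum, Finset.sum_add_distrib, Matrix.one_apply]
    simp
    ring
  have : ∫ h : E N, h i * h j * h k * h l / ‖h‖ ^ 4 * ρ h = quartic ρ (s i) (s j) (s k) (s l) := by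
    simp only [quartic, hs, inner_single]
  rw [this, hq, ← mul_assoc, hκ1, one_mul]

/-- The matrix-valued kernel of the non-local Hessian, without the weight. -/
noncomputable def kern (i j : Fin N) (h : E N) : ℝ :=
  (h i * h j - ‖h‖ ^ 2 / (N + 2) * (1 : Matrix (Fin N) (Fin N) ℝ) i j) / ‖h‖ ^ 2

theorem measurable_kern (i j : Fin N) : Measurable (kern (N := N) i j) := by
  unfold kern
  fun_prop

theorem abs_apply_le_norm (h : E N) (i : Fin N) : |h i| ≤ ‖h‖ := by
  simpa using PiLp.norm_apply_le h i

theorem abs_kern_le (i j : Fin N) (h : E N) : |kern i j h| ≤ 2 := by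
  rcases eq_or_ne h 0 with rfl | h0
  · simp [kern]
  · have hn : 0 < ‖h‖ := norm_pos_iff.2 h0
    rw [kern, abs_div, abs_of_nonneg (by positivity : 0 ≤ ‖h‖ ^ 2), div_le_iff₀ (by positivity)]
    have h1 : |h i * h j| ≤ ‖h‖ ^ 2 := by
      rw [abs_mul, sq]
      exact mul_le_mul (abs_apply_le_norm h i) (abs_apply_le_norm h j) (abs_nonneg _) hn.le
    have h2 : |‖h‖ ^ 2 / (N + 2) * (1 : Matrix (Fin N) (Fin N) ℝ) i j| ≤ ‖h‖ ^ 2 := by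
      have h3 : ‖h‖ ^ 2 / ((N : ℝ) + 2) ≤ ‖h‖ ^ 2 :=
        div_le_self (by positivity) (by linarith [(Nat.cast_nonneg N : (0 : ℝ) ≤ N)])
      rw [abs_mul, abs_of_nonneg (by positivity : 0 ≤ ‖h‖ ^ 2 / ((N : ℝ) + 2)), Matrix.one_apply]
      split_ifs
      · simpa using h3
      · simp
    calc _ ≤ |h i * h j| + |‖h‖ ^ 2 / (N + 2) * (1 : Matrix (Fin N) (Fin N) ℝ) i j| := abs_sub _ _
      _ ≤ _ := by linarith

theorem abs_mul_div_sq_le (k l : Fin N) (h : E N) : |h k * h l / ‖h‖ ^ 2| ≤ 1 := by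
  rw [abs_div, abs_mul, abs_of_nonneg (by positivity : 0 ≤ ‖h‖ ^ 2)]
  refine div_le_one_of_le₀ ?_ (by positivity)
  rw [sq]
  exact mul_le_mul (abs_apply_le_norm h k) (abs_apply_le_norm h l) (abs_nonneg _) (norm_nonneg _)

theorem nlHessian_eq (ρ u : E N → ℝ) (x : E N) (i j : Fin N) :
    nlHessian ρ u x i j
      = (N * (N + 2) / 2 : ℝ) * ∫ h, secondDiff u h x / ‖h‖ ^ 2 * kern i j h * ρ h := rfl

theorem integrable_kern_moment {ρ : E N → ℝ} (hρ : Integrable ρ volume) (i j k l : Fin N) :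
    Integrable (fun h : E N => h k * h l / ‖h‖ ^ 2 * kern i j h * ρ h) volume := by
  refine integrable_mul_of_bound hρ (B := 1 * 2) ?_ fun h => ?_
  · have := measurable_kern (N := N) i j
    exact Measurable.aestronglyMeasurable (by fun_prop)
  · rw [abs_mul]
    exact mul_le_mul (abs_mul_div_sq_le k l h) (abs_kern_le i j h) (abs_nonneg _) zero_le_one

/-- The kernel of the non-local Hessian reproduces the coefficients of a quadratic form. -/
theorem kern_moment (hN : 1 ≤ N) {ρ : E N → ℝ} (hr : ∀ x y, ‖x‖ = ‖y‖ → ρ x = ρ y)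
    (h1 : ∫ x, ρ x = 1) (i j k l : Fin N) :
    (N * (N + 2) / 2 : ℝ) * ∫ h : E N, h k * h l / ‖h‖ ^ 2 * kern i j h * ρ h
      = ((1 : Matrix (Fin N) (Fin N) ℝ) i k * (1 : Matrix (Fin N) (Fin N) ℝ) j l
        + (1 : Matrix (Fin N) (Fin N) ℝ) i l * (1 : Matrix (Fin N) (Fin N) ℝ) j k) / 2 := by
  have hρ := integrable_of_integral_eq_one h1
  have hi : ∀ i j k l : Fin N,
      Integrable (fun h : E N => h i * h j * h k * h l / ‖h‖ ^ 4 * ρ h) volume := by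
    intro i j k l
    simpa only [inner_single] using integrable_quartic hρ (EuclideanSpace.single i 1)
      (EuclideanSpace.single j 1) (EuclideanSpace.single k 1) (EuclideanSpace.single l 1)
  -- Second moments are contractions of fourth moments, as `∑ h_m² = |h|²`.
  have h2 : (N * (N + 2) : ℝ) * ∫ h : E N, h k * h l / ‖h‖ ^ 2 * ρ h
      = (N + 2) * (1 : Matrix (Fin N) (Fin N) ℝ) k l := by
    have e : ∫ h : E N, h k * h l / ‖h‖ ^ 2 * ρ h
        = ∑ m, ∫ h : E N, h m * h m * h k * h l / ‖h‖ ^ 4 * ρ h := by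
      rw [← integral_finsetSum _ fun m _ => hi m m k l]
      refine integral_congr_ae ?_
      filter_upwards [ae_ne_zero hN] with h h0
      have hn : ‖h‖ ≠ 0 := norm_ne_zero_iff.2 h0
      have : ∀ m, h m * h m * h k * h l / ‖h‖ ^ 4 * ρ h
          = (h m * h m) * (h k * h l / ‖h‖ ^ 4 * ρ h) := fun m => by ring
      simp only [this, ← Finset.sum_mul, sum_sq_eq]
      field_simp
    rw [e, Finset.mul_sum]
    simp only [quartic_moment hN hr h1, Finset.sum_add_distrib, Matrix.one_apply]
    rcases eq_or_ne k l with rfl | hkl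
    · simp
      ring
    · simp [hkl, hkl.symm]
  have hi2 : Integrable (fun h : E N => h k * h l / ‖h‖ ^ 2 * ρ h) volume := by
    refine integrable_mul_of_bound hρ (B := 1) ?_ (abs_mul_div_sq_le k l)
    exact Measurable.aestronglyMeasurable (by fun_prop)
  -- The coefficient `1 / (N + 2)` in the kernel is exactly what cancels the pairing `δ_ij δ_kl`,
  -- leaving the two pairings that read off the `(i, j)` entry.
  have h3 : ∫ h : E N, h k * h l / ‖h‖ ^ 2 * kern i j h * ρ h
      = (∫ h : E N, h i * h j * h k * h l / ‖h‖ ^ 4 * ρ h)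
        - (1 : Matrix (Fin N) (Fin N) ℝ) i j / (N + 2) * ∫ h : E N, h k * h l / ‖h‖ ^ 2 * ρ h := by
    rw [← integral_const_mul, ← integral_sub (hi i j k l) (hi2.const_mul _)]
    refine integral_congr_ae ?_
    filter_upwards [ae_ne_zero hN] with h h0
    have hn : ‖h‖ ≠ 0 := norm_ne_zero_iff.2 h0
    rw [kern]
    field_simp
  have h4 := quartic_moment hN hr h1 i j k l
  have hN2 : (N : ℝ) + 2 ≠ 0 := by positivity
  rw [h3]
  have e : (N * (N + 2) / 2 : ℝ) * ((∫ h : E N, h i * h j * h k * h l / ‖h‖ ^ 4 * ρ h)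
        - (1 : Matrix (Fin N) (Fin N) ℝ) i j / (N + 2) * ∫ h : E N, h k * h l / ‖h‖ ^ 2 * ρ h)
      = ((N * (N + 2) * ∫ h : E N, h i * h j * h k * h l / ‖h‖ ^ 4 * ρ h)
        - (1 : Matrix (Fin N) (Fin N) ℝ) i j / (N + 2)
          * (N * (N + 2) * ∫ h : E N, h k * h l / ‖h‖ ^ 2 * ρ h)) / 2 := by ring
  rw [e, h4, h2]
  field_simp
  ring

/-! ### Consistency of the non-local Hessian on smooth functions -/

/-- Integrals against a concentrating sequence of kernels. -/
theorem tendsto_integral_mul_kernel {ρ : ℕ → E N → ℝ} (hρ : IsRadialMollifierSeq ρ) {g : E N → ℝ}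
    (hg : AEStronglyMeasurable g volume) {B : ℝ} (hB : ∀ h, |g h| ≤ B)
    (h0 : ∀ ε > 0, ∃ γ > 0, ∀ h, ‖h‖ ≤ γ → |g h| ≤ ε) :
    Tendsto (fun n => ∫ h, g h * ρ n h) atTop (𝓝 0) := by
  have B0 : 0 ≤ B := (abs_nonneg _).trans (hB 0)
  rw [Metric.tendsto_atTop]
  intro ε hε
  -- Near the origin `g` is small and `ρ n` has mass at most one; beyond radius `γ` it is bounded by
  -- `B` and the mass is small. Using `B + 1` avoids division by zero.
  obtain ⟨γ, hγ, hγg⟩ := h0 (ε / 2) (half_pos hε)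
  obtain ⟨n₀, hn₀⟩ := (Metric.tendsto_atTop.1 (hρ.tendsto_tail γ hγ)) (ε / (2 * (B + 1)))
    (by positivity)
  refine ⟨n₀, fun n hn => ?_⟩
  have hi := integrable_of_integral_eq_one (hρ.integral_eq_one n)
  have hms : MeasurableSet {x : E N | γ < ‖x‖} := (isOpen_lt continuous_const continuous_norm).measurableSet
  have ht := hn₀ n hn
  rw [Real.dist_eq, sub_zero, ← integral_indicator hms] at ht
  rw [Real.dist_eq, sub_zero]
  have hle : ∀ h, |g h * ρ n h| ≤ ε / 2 * ρ n h + B * Set.indicator {x | γ < ‖x‖} (ρ n) h := by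
    intro h
    rw [abs_mul, abs_of_nonneg (hρ.nonneg n h)]
    by_cases hh : γ < ‖h‖
    · rw [Set.indicator_of_mem (s := {x | γ < ‖x‖}) hh]
      nlinarith [hB h, hρ.nonneg n h, mul_nonneg hε.le (hρ.nonneg n h),
        mul_le_mul_of_nonneg_right (hB h) (hρ.nonneg n h)]
    · rw [Set.indicator_of_notMem (s := {x | γ < ‖x‖}) hh, mul_zero, add_zero]
      exact mul_le_mul_of_nonneg_right (hγg h (not_lt.1 hh)) (hρ.nonneg n h)
  calc |∫ h, g h * ρ n h| ≤ ∫ h, |g h * ρ n h| := abs_integral_le_integral_abs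
    _ ≤ ∫ h, (ε / 2 * ρ n h + B * Set.indicator {x | γ < ‖x‖} (ρ n) h) :=
        integral_mono (integrable_mul_of_bound hi hg hB).abs
          ((hi.const_mul _).add ((hi.indicator hms).const_mul _)) hle
    _ = ε / 2 + B * ∫ h, Set.indicator {x | γ < ‖x‖} (ρ n) h := by
        rw [integral_add (hi.const_mul _) ((hi.indicator hms).const_mul _), integral_const_mul,
          integral_const_mul, hρ.integral_eq_one n, mul_one]
    _ ≤ ε / 2 + B * (ε / (2 * (B + 1))) := by
        gcongr
        exact (le_abs_self _).trans ht.le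
    _ < ε := by
        have : B * (ε / (2 * (B + 1))) < ε / 2 := by
          rw [mul_div_assoc', div_lt_div_iff₀ (by positivity) (by positivity)]
          nlinarith
        linarith

theorem pderiv_comm {Φ : E N → ℝ} (hΦ : ContDiff ℝ ∞ Φ) (i j : Fin N) (x : E N) :
    pderiv i (pderiv j Φ) x = pderiv j (pderiv i Φ) x := by
  have hd : Differentiable ℝ (fderiv ℝ Φ) := (hΦ.fderiv_right (m := ∞) (by simp)).differentiable (by simp)
  have h : ∀ v w : E N, fderiv ℝ (fun y => fderiv ℝ Φ y v) x w = fderiv ℝ (fderiv ℝ Φ) x w v := by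
    intro v w
    have := ((hd x).hasFDerivAt.clm_apply (hasFDerivAt_const v x)).fderiv
    rw [this]
    simp
  have hs : IsSymmSndFDerivAt ℝ Φ x := hΦ.contDiffAt.isSymmSndFDerivAt
    (by simpa using (WithTop.coe_le_coe.2 (le_top : (2 : ℕ∞) ≤ ⊤)))
  change fderiv ℝ (fun y => fderiv ℝ Φ y _) x _ = fderiv ℝ (fun y => fderiv ℝ Φ y _) x _
  rw [h, h]
  exact hs _ _

/-- Consistency of the non-local Hessian. -/
theorem tendsto_nlHessian_zero (hN : 1 ≤ N) {ρ : ℕ → E N → ℝ} (hρ : IsRadialMollifierSeq ρ)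
    {Φ : E N → ℝ} (hΦ : ContDiff ℝ ∞ Φ) {M : ℝ}
    (hM : ∀ k l, ∀ y : E N, |pderiv l (pderiv k Φ) y| ≤ M) (i j : Fin N) :
    Tendsto (fun n => nlHessian (ρ n) Φ 0 i j) atTop (𝓝 (pderiv i (pderiv j Φ) 0)) := by
  set a : Fin N → Fin N → ℝ := fun k l => pderiv l (pderiv k Φ) 0 with ha
  have M0 : 0 ≤ M := (abs_nonneg _).trans (hM i i 0)
  -- The Taylor remainder divided by `|h|²`: it is bounded, and it vanishes as `h` tends to `0` by
  -- continuity of the second derivatives.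
  set R : E N → ℝ := fun h => (secondDiff Φ h 0 - ∑ k, ∑ l, h k * h l * a k l) / ‖h‖ ^ 2 with hR
  have hRm : Measurable R := by
    have h1 : Measurable Φ := hΦ.continuous.measurable
    simp only [hR, secondDiff]
    fun_prop
  have hRle : ∀ (h : E N) (M' : ℝ), 0 ≤ M' →
      (∀ k l, ∀ y : E N, ‖y‖ ≤ ‖h‖ → |pderiv l (pderiv k Φ) y - a k l| ≤ M') →
      |R h| ≤ 2 * N ^ 2 * M' := by
    intro h M' hM' H
    have := abs_secondDiff_sub_le hΦ H
    rw [hR]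
    dsimp only
    rw [abs_div, abs_of_nonneg (by positivity : 0 ≤ ‖h‖ ^ 2)]
    refine div_le_of_le_mul₀ (by positivity) (by positivity) ?_
    linarith
  have hRB : ∀ h, |R h * kern i j h| ≤ 2 * N ^ 2 * (2 * M) * 2 := by
    intro h
    rw [abs_mul]
    refine mul_le_mul (hRle h (2 * M) (by positivity) fun k l y _ => ?_) (abs_kern_le i j h)
      (abs_nonneg _) (by positivity)
    exact (abs_sub _ _).trans (by linarith [hM k l y, hM k l 0])
  have hR0 : ∀ ε > 0, ∃ γ > 0, ∀ h, ‖h‖ ≤ γ → |R h * kern i j h| ≤ ε := by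
    intro ε hε
    have hN0 : (0 : ℝ) < N := by exact_mod_cast hN
    have hc : ∀ᶠ y in 𝓝 (0 : E N), ∀ k l, |pderiv l (pderiv k Φ) y - a k l| ≤ ε / (4 * N ^ 2) := by
      rw [eventually_all]; intro k
      rw [eventually_all]; intro l
      have := ((pderiv_contDiff (pderiv_contDiff hΦ k) l).continuous.tendsto 0)
      have := this.eventually (Metric.closedBall_mem_nhds _ (by positivity : 0 < ε / (4 * N ^ 2)))
      filter_upwards [this] with y hy
      simpa [Real.dist_eq] using hy
    obtain ⟨γ, hγ, hγ'⟩ := Metric.nhds_basis_closedBall.eventually_iff.1 hc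
    refine ⟨γ, hγ, fun h hh => ?_⟩
    have h1 := hRle h (ε / (4 * N ^ 2)) (by positivity) fun k l y hy =>
      hγ' (by simpa using hy.trans hh) k l
    rw [abs_mul]
    calc _ ≤ (2 * N ^ 2 * (ε / (4 * N ^ 2))) * 2 :=
          mul_le_mul h1 (abs_kern_le i j h) (abs_nonneg _) (by positivity)
      _ = ε := by field_simp; norm_num
  have hRk : AEStronglyMeasurable (fun h => R h * kern i j h) volume :=
    (hRm.mul (measurable_kern i j)).aestronglyMeasurable
  have hlim := (tendsto_integral_mul_kernel hρ hRk hRB hR0).const_mul (N * (N + 2) / 2 : ℝ)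
  -- For every `n` the quadratic part reproduces the Hessian exactly, so only the remainder depends
  -- on `n`.
  have key : ∀ n, nlHessian (ρ n) Φ 0 i j
      = (N * (N + 2) / 2 : ℝ) * (∫ h, R h * kern i j h * ρ n h) + pderiv i (pderiv j Φ) 0 := by
    intro n
    have hi := integrable_of_integral_eq_one (hρ.integral_eq_one n)
    have e : ∫ h, secondDiff Φ h 0 / ‖h‖ ^ 2 * kern i j h * ρ n h
        = (∫ h, R h * kern i j h * ρ n h)
          + ∑ k, ∑ l, a k l * ∫ h : E N, h k * h l / ‖h‖ ^ 2 * kern i j h * ρ n h := by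
      simp only [← integral_const_mul]
      have e1 : ∀ k, ∑ l, ∫ h : E N, a k l * (h k * h l / ‖h‖ ^ 2 * kern i j h * ρ n h)
          = ∫ h : E N, ∑ l, a k l * (h k * h l / ‖h‖ ^ 2 * kern i j h * ρ n h) := fun k =>
        (integral_finsetSum _ fun l _ => (integrable_kern_moment hi i j k l).const_mul _).symm
      simp only [e1]
      rw [← integral_finsetSum _ fun k _ => integrable_finsetSum _ fun l _ =>
        (integrable_kern_moment hi i j k l).const_mul _,
        ← integral_add (integrable_mul_of_bound hi hRk hRB)
        (integrable_finsetSum _ fun k _ => integrable_finsetSum _ fun l _ =>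
        (integrable_kern_moment hi i j k l).const_mul _)]
      congr 1
      funext h
      have e2 : ∀ k l, a k l * (h k * h l / ‖h‖ ^ 2 * kern i j h * ρ n h)
          = (h k * h l * a k l) * (kern i j h * ρ n h / ‖h‖ ^ 2) := fun k l => by ring
      simp only [e2, ← Finset.sum_mul, hR]
      ring
    rw [nlHessian_eq, e, mul_add, Finset.mul_sum]
    congr 1
    have e3 : ∀ k, (N * (N + 2) / 2 : ℝ) *
          ∑ l, a k l * ∫ h : E N, h k * h l / ‖h‖ ^ 2 * kern i j h * ρ n h
        = ∑ l, a k l * (((1 : Matrix (Fin N) (Fin N) ℝ) i k * (1 : Matrix (Fin N) (Fin N) ℝ) j l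
        + (1 : Matrix (Fin N) (Fin N) ℝ) i l * (1 : Matrix (Fin N) (Fin N) ℝ) j k) / 2) := by
      intro k
      rw [Finset.mul_sum]
      refine Finset.sum_congr rfl fun l _ => ?_
      rw [← kern_moment hN (hρ.radial n) (hρ.integral_eq_one n)]
      ring
    simp only [e3, Matrix.one_apply]
    have e4 : ∀ k l, a k l * (((if i = k then (1 : ℝ) else 0) * (if j = l then 1 else 0)
        + (if i = l then 1 else 0) * (if j = k then 1 else 0)) / 2)
        = (if i = k then (if j = l then a k l / 2 else 0) else 0)
          + (if j = k then (if i = l then a k l / 2 else 0) else 0) := by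
      intro k l; split_ifs <;> ring
    simp only [e4, Finset.sum_add_distrib]
    -- The moments select `(a_ij + a_ji) / 2`, which is `a_ij` by equality of mixed partials.
    simp [ha, pderiv_comm hΦ j i]
  simp only [key]
  simpa using hlim.add_const (pderiv i (pderiv j Φ) 0)

/-! ### The converse of Hölder's inequality -/

/-- Converse of Hölder's inequality for lower integrals. -/
theorem lintegral_rpow_le_of_forall_lintegral_mul_le {α : Type*} [MeasurableSpace α]
    {μ : Measure α} [SigmaFinite μ] {p q : ℝ} (hpq : p.HolderConjugate q) {f : α → ℝ≥0∞}
    (hf : Measurable f) {C : ℝ≥0∞}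
    (h : ∀ g : α → ℝ≥0∞, Measurable g → ∫⁻ x, g x ^ q ∂μ ≠ ⊤ →
      ∫⁻ x, f x * g x ∂μ ≤ C * (∫⁻ x, g x ^ q ∂μ) ^ (1 / q)) :
    ∫⁻ x, f x ^ p ∂μ ≤ C ^ p := by
  have hp0 : 0 < p := hpq.pos
  have hp1 : 0 < p - 1 := hpq.sub_one_pos
  -- Truncating in height and to sets of finite measure makes `∫ F_k ^ p` finite, so that a power of
  -- it can be cancelled below.
  set F : ℕ → α → ℝ≥0∞ := fun k => (spanningSets μ k).indicator fun x => min (f x) k with hF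
  have hFm : ∀ k, Measurable (F k) := fun k =>
    (hf.min measurable_const).indicator (measurableSet_spanningSets μ k)
  have hFle : ∀ k x, F k x ≤ f x := fun k x =>
    (Set.indicator_le_self' (fun _ _ => zero_le) x).trans (min_le_left _ _)
  have hfin : ∀ k, ∫⁻ x, F k x ^ p ∂μ ≠ ⊤ := by
    intro k
    have h1 : ∀ x, F k x ^ p ≤ (spanningSets μ k).indicator (fun _ => (k : ℝ≥0∞) ^ p) x := by
      intro x
      by_cases hx : x ∈ spanningSets μ k
      · rw [hF]
        simp only [Set.indicator_of_mem hx]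
        exact ENNReal.rpow_le_rpow (min_le_right _ _) hp0.le
      · rw [hF]
        simp only [Set.indicator_of_notMem hx]
        simp [hp0]
    refine ((lintegral_mono h1).trans_lt ?_).ne
    rw [lintegral_indicator_const (measurableSet_spanningSets μ k)]
    exact ENNReal.mul_lt_top (ENNReal.rpow_lt_top_of_nonneg hp0.le (by simp))
      (measure_spanningSets_lt_top μ k)
  have hbd : ∀ k, ∫⁻ x, F k x ^ p ∂μ ≤ C ^ p := by
    intro k
    -- The extremal function in Hölder's inequality is `F ^ (p - 1)`, because `(p - 1) q = p`.
    have e : ∀ x, (F k x ^ (p - 1)) ^ q = F k x ^ p := fun x => by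
      rw [← ENNReal.rpow_mul, hpq.sub_one_mul_conj]
    have h1 := h (fun x => F k x ^ (p - 1)) ((hFm k).pow_const _) (by simpa only [e] using hfin k)
    simp only [e] at h1
    set I := ∫⁻ x, F k x ^ p ∂μ with hI
    have h2 : I ≤ C * I ^ (1 / q) := by
      refine le_trans (lintegral_mono fun x => ?_) h1
      calc F k x ^ p = F k x * F k x ^ (p - 1) := by
            conv_rhs => enter [1]; rw [← ENNReal.rpow_one (F k x)]
            rw [← ENNReal.rpow_add_of_nonneg _ _ zero_le_one hp1.le]
            congr 1; ring
        _ ≤ f x * F k x ^ (p - 1) := by gcongr; exact hFle k x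
    rcases eq_or_ne I 0 with h0 | h0
    · rw [h0]; exact zero_le
    · have h3 : I ^ (1 / p) ≤ C := by
        have hq0 : I ^ (1 / q) ≠ 0 := (ENNReal.rpow_pos (pos_iff_ne_zero.2 h0) (hfin k)).ne'
        have hqt : I ^ (1 / q) ≠ ⊤ :=
          ENNReal.rpow_ne_top_of_nonneg (by have := hpq.symm.pos; positivity) (hfin k)
        rw [← ENNReal.mul_le_mul_iff_left hq0 hqt, ← ENNReal.rpow_add _ _ h0 (hfin k)]
        have : 1 / p + 1 / q = 1 := by simpa using hpq.inv_add_inv_eq_one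
        rw [this, ENNReal.rpow_one]
        exact h2
      calc I = (I ^ (1 / p)) ^ p := by
            rw [← ENNReal.rpow_mul, one_div, inv_mul_cancel₀ hp0.ne', ENNReal.rpow_one]
        _ ≤ C ^ p := ENNReal.rpow_le_rpow h3 hp0.le
  have hlim : ∀ x, Tendsto (fun k => F k x ^ p) atTop (𝓝 (f x ^ p)) := by
    intro x
    refine (ENNReal.continuous_rpow_const.tendsto _).comp ?_
    have h1 : Tendsto (fun k : ℕ => min (f x) (k : ℝ≥0∞)) atTop (𝓝 (min (f x) ⊤)) :=
      tendsto_const_nhds.min ENNReal.tendsto_nat_nhds_top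
    rw [min_top_right] at h1
    refine h1.congr' ?_
    filter_upwards [eventually_ge_atTop (spanningSetsIndex μ x)] with k hk
    rw [hF]
    simp only [Set.indicator_of_mem (mem_spanningSets_of_index_le μ x hk)]
  calc ∫⁻ x, f x ^ p ∂μ = ∫⁻ x, liminf (fun k => F k x ^ p) atTop ∂μ :=
        lintegral_congr fun x => (hlim x).liminf_eq.symm
    _ ≤ liminf (fun k => ∫⁻ x, F k x ^ p ∂μ) atTop :=
        lintegral_liminf_le fun k => (hFm k).pow_const _
    _ ≤ C ^ p := by
        refine (liminf_le_liminf (Eventually.of_forall hbd)).trans ?_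
        simp

/-- The smooth function `a / √(a² + δ²)` replaces the sign of `a` at a cost of at most `δ`. -/
theorem abs_sub_le_sq_div_sqrt {a δ : ℝ} (hδ : 0 < δ) :
    |a| - δ ≤ a * (a / Real.sqrt (a ^ 2 + δ ^ 2)) := by
  have hs : 0 < Real.sqrt (a ^ 2 + δ ^ 2) := Real.sqrt_pos.2 (by positivity)
  have hle : Real.sqrt (a ^ 2 + δ ^ 2) ≤ |a| + δ := by
    refine Real.sqrt_le_iff.2 ⟨by positivity, ?_⟩
    have := sq_abs a
    nlinarith [abs_nonneg a, mul_nonneg (abs_nonneg a) hδ.le]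
  rw [mul_div_assoc', le_div_iff₀ hs]
  rcases le_or_gt |a| δ with h | h
  · have : (|a| - δ) * Real.sqrt (a ^ 2 + δ ^ 2) ≤ 0 :=
      mul_nonpos_of_nonpos_of_nonneg (by linarith) hs.le
    nlinarith [mul_self_nonneg a]
  · have := mul_le_mul_of_nonneg_left hle (by linarith : 0 ≤ |a| - δ)
    have h2 := abs_mul_abs_self a
    nlinarith

theorem isTest_div_sqrt {g : E N → ℝ} (hg : IsTest g) {δ : ℝ} (hδ : 0 < δ) :
    IsTest (fun x => g x / Real.sqrt (g x ^ 2 + δ ^ 2)) := by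
  have hpos : ∀ x, g x ^ 2 + δ ^ 2 ≠ 0 := fun x => by positivity
  refine ⟨hg.1.div (((hg.1.pow 2).add contDiff_const).sqrt hpos) fun x =>
    (Real.sqrt_pos.2 (by positivity)).ne', ?_⟩
  refine hg.2.mono fun x hx => ?_
  rw [Function.mem_support] at hx ⊢
  contrapose! hx
  simp [hx]

/-- Test functions are not dense in `L^∞`, so the sign of `f` cannot be approximated in norm.
Instead `f` is approximated in `L^1` by a test function `g`, and the smoothed sign of `g` is the
competitor. The three errors `ε` come from replacing `f` by `g` in the pairing, from the smoothing,
and from returning to `f`. -/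
theorem eLpNorm_one_le_of_test {f : E N → ℝ} (hf : MemLp f 1 volume) {C : ℝ} (hC : 0 ≤ C)
    (h : ∀ φ : E N → ℝ, IsTest φ → |∫ x, f x * φ x| ≤ C * (eLpNorm φ ⊤ volume).toReal) :
    eLpNorm f 1 volume ≤ ENNReal.ofReal C := by
  have key : ∀ ε : ℝ, 0 < ε → eLpNorm f 1 volume ≤ ENNReal.ofReal (C + 3 * ε) := by
    intro ε hε
    obtain ⟨g, hg2, hg1, hfg⟩ := hf.exist_eLpNorm_sub_le (by simp) le_rfl hε
    have hg : IsTest g := ⟨hg1, hg2⟩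
    set K := tsupport g with hK
    have hKc : IsCompact K := hg2
    have hKm : MeasurableSet K := hKc.measurableSet
    -- The smoothing loses `δ` only on the support `K` of `g`, in total at most `ε`.
    set δ := ε / (volume.real K + 1) with hδ
    have hδ0 : 0 < δ := by positivity
    set φ : E N → ℝ := fun x => g x / Real.sqrt (g x ^ 2 + δ ^ 2) with hφ
    have hφt : IsTest φ := isTest_div_sqrt hg hδ0
    have hφ1 : ∀ x, |φ x| ≤ 1 := by
      intro x
      rw [hφ]
      dsimp only
      rw [abs_div, abs_of_nonneg (Real.sqrt_nonneg _)]
      refine div_le_one_of_le₀ ?_ (Real.sqrt_nonneg _)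
      rw [← Real.sqrt_sq_eq_abs]
      exact Real.sqrt_le_sqrt (by nlinarith)
    have hφn : (eLpNorm φ ⊤ volume).toReal ≤ 1 := by
      refine ENNReal.toReal_le_of_le_ofReal zero_le_one ?_
      simpa using eLpNorm_le_of_ae_bound (p := ⊤) (μ := (volume : Measure (E N)))
        (f := φ) (C := 1) (ae_of_all _ hφ1)
    have hgi : Integrable g volume := memLp_one_iff_integrable.1 (hg.memLp 1)
    have hfi : Integrable f volume := memLp_one_iff_integrable.1 hf
    have hφm : AEStronglyMeasurable φ volume := hφt.continuous.aestronglyMeasurable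
    have hfφ : Integrable (fun x => f x * φ x) volume := hfi.mul_bdd hφm (ae_of_all _ hφ1)
    have hgφ : Integrable (fun x => g x * φ x) volume := hgi.mul_bdd hφm (ae_of_all _ hφ1)
    have hd : ∫ x, |f x - g x| ≤ ε := by
      have h1 : eLpNorm (f - g) 1 volume = ENNReal.ofReal (∫ x, |f x - g x|) := by
        rw [eLpNorm_one_eq_lintegral_enorm, ← ofReal_integral_norm_eq_lintegral_enorm (hfi.sub hgi)]
        rfl
      rw [h1] at hfg
      exact (ENNReal.ofReal_le_ofReal_iff hε.le).1 hfg
    have h1 : ∫ x, f x * φ x ≤ C :=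
      (le_abs_self _).trans ((h φ hφt).trans (mul_le_of_le_one_right hC hφn))
    have h2 : ∫ x, g x * φ x ≤ C + ε := by
      have : ∫ x, (g x * φ x - f x * φ x) ≤ ∫ x, |f x - g x| := by
        refine integral_mono (hgφ.sub hfφ) (hfi.sub hgi).abs fun x => ?_
        calc g x * φ x - f x * φ x = (g x - f x) * φ x := by ring
          _ ≤ |g x - f x| * |φ x| := by rw [← abs_mul]; exact le_abs_self _
          _ ≤ |f x - g x| := by
            rw [abs_sub_comm]; exact mul_le_of_le_one_right (abs_nonneg _) (hφ1 x)
      rw [integral_sub hgφ hfφ] at this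
      linarith
    have hKi : Integrable (K.indicator fun _ => δ) volume :=
      (integrable_indicator_iff hKm).2 (integrableOn_const hKc.measure_lt_top.ne)
    have h3 : ∫ x, |g x| ≤ C + 2 * ε := by
      have h4 : ∫ x, (|g x| - K.indicator (fun _ => δ) x) ≤ ∫ x, g x * φ x := by
        refine integral_mono (hgi.abs.sub hKi) hgφ fun x => ?_
        by_cases hx : x ∈ K
        · simp only [Set.indicator_of_mem hx]
          exact abs_sub_le_sq_div_sqrt hδ0
        · simp only [Set.indicator_of_notMem hx]
          simp [image_eq_zero_of_notMem_tsupport hx]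
      rw [integral_sub hgi.abs hKi, integral_indicator_const _ hKm, smul_eq_mul] at h4
      have h5 : volume.real K * δ ≤ ε := by
        rw [hδ, mul_div_assoc', div_le_iff₀ (by positivity)]
        nlinarith [measureReal_nonneg (μ := (volume : Measure (E N))) (s := K)]
      linarith
    have h6 : ∫ x, |f x| ≤ C + 3 * ε := by
      have : ∫ x, |f x| ≤ ∫ x, (|f x - g x| + |g x|) :=
        integral_mono hfi.abs ((hfi.sub hgi).abs.add hgi.abs) fun x => by
          simpa using abs_add_le (f x - g x) (g x)
      have e : ∫ x, (|f x - g x| + |g x|) = (∫ x, |f x - g x|) + ∫ x, |g x| :=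
        integral_add (hfi.sub hgi).abs hgi.abs
      linarith
    rw [eLpNorm_one_eq_lintegral_enorm, ← ofReal_integral_norm_eq_lintegral_enorm hfi]
    exact ENNReal.ofReal_le_ofReal h6
  have hlim : Tendsto (fun ε : ℝ => ENNReal.ofReal (C + 3 * ε)) (𝓝[>] 0) (𝓝 (ENNReal.ofReal C)) := by
    refine ENNReal.tendsto_ofReal ?_
    have : Tendsto (fun ε : ℝ => C + 3 * ε) (𝓝 0) (𝓝 (C + 3 * 0)) :=
      (continuous_const.add (continuous_const.mul continuous_id)).tendsto 0
    simpa using this.mono_left nhdsWithin_le_nhds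
  exact ge_of_tendsto hlim (eventually_mem_nhdsWithin.mono fun ε hε => key ε hε)

/-- Test functions are dense in `L^q` for finite `q`, and both sides are continuous in `L^q`. -/
theorem abs_integral_mul_le_of_test {p q : ℝ≥0∞} [hpq : p.HolderConjugate q] (hq : q ≠ ⊤)
    {f : E N → ℝ} (hf : MemLp f p volume) {C : ℝ} (hC : 0 ≤ C)
    (h : ∀ φ : E N → ℝ, IsTest φ → |∫ x, f x * φ x| ≤ C * (eLpNorm φ q volume).toReal)
    {φ : E N → ℝ} (hφ : MemLp φ q volume) :
    |∫ x, f x * φ x| ≤ C * (eLpNorm φ q volume).toReal := by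
  refine le_of_forall_pos_le_add fun ε hε => ?_
  have hq1 : 1 ≤ q := ENNReal.HolderConjugate.one_le q p
  set A := (eLpNorm f p volume).toReal with hA
  have hA0 : 0 ≤ A := ENNReal.toReal_nonneg
  set η := ε / (A + C + 1) with hη
  have hη0 : 0 < η := by positivity
  obtain ⟨g, hg2, hg1, hfg⟩ := hφ.exist_eLpNorm_sub_le hq hq1 hη0
  have hg : IsTest g := ⟨hg1, hg2⟩
  have hgq := hg.memLp q
  have e1 : ∫ x, f x * φ x = (∫ x, f x * g x) + ∫ x, f x * (φ - g) x := by
    rw [← integral_add (integrable_mul_of_holderConjugate hf hgq)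
      (integrable_mul_of_holderConjugate hf (hφ.sub hgq))]
    congr 1; funext x; simp only [Pi.sub_apply]; ring
  have e2 : (eLpNorm (φ - g) q volume).toReal ≤ η := ENNReal.toReal_le_of_le_ofReal hη0.le hfg
  have e3 : (eLpNorm g q volume).toReal ≤ (eLpNorm φ q volume).toReal + η := by
    have e4 : eLpNorm g q volume ≤ eLpNorm φ q volume + eLpNorm (φ - g) q volume := by
      have : g = φ - (φ - g) := by simp
      conv_lhs => rw [this]
      exact eLpNorm_sub_le hφ.1 (hφ.sub hgq).1 hq1
    have := ENNReal.toReal_mono (ENNReal.add_ne_top.2 ⟨hφ.2.ne, (hφ.sub hgq).2.ne⟩) e4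
    rw [ENNReal.toReal_add hφ.2.ne (hφ.sub hgq).2.ne] at this
    linarith
  have e5 := abs_integral_mul_le (q := q) hf (hφ.sub hgq)
  have e6 := h g hg
  have e7 : (A + C) * η ≤ ε := by
    rw [hη, mul_div_assoc', div_le_iff₀ (by positivity)]
    nlinarith
  calc |∫ x, f x * φ x| ≤ |∫ x, f x * g x| + |∫ x, f x * (φ - g) x| := by
        rw [e1]; exact abs_add_le _ _
    _ ≤ C * ((eLpNorm φ q volume).toReal + η) + A * η := by
        refine add_le_add (e6.trans (mul_le_mul_of_nonneg_left e3 hC)) (e5.trans ?_)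
        exact mul_le_mul_of_nonneg_left e2 hA0
    _ ≤ C * (eLpNorm φ q volume).toReal + ε := by nlinarith

/-- Converse of Hölder's inequality, tested against smooth compactly supported functions. -/
theorem eLpNorm_le_of_test {p q : ℝ≥0∞} [hpq : p.HolderConjugate q] (hp : p ≠ ⊤)
    {f : E N → ℝ} (hf : MemLp f p volume) {C : ℝ} (hC : 0 ≤ C)
    (h : ∀ φ : E N → ℝ, IsTest φ → |∫ x, f x * φ x| ≤ C * (eLpNorm φ q volume).toReal) :
    eLpNorm f p volume ≤ ENNReal.ofReal C := by
  wlog hfm : StronglyMeasurable f generalizing f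
  · rw [eLpNorm_congr_ae hf.1.ae_eq_mk]
    refine this ((memLp_congr_ae hf.1.ae_eq_mk).1 hf) (fun φ hφ => ?_) hf.1.stronglyMeasurable_mk
    refine le_trans (le_of_eq ?_) (h φ hφ)
    congr 1
    refine integral_congr_ae ?_
    filter_upwards [hf.1.ae_eq_mk] with x hx
    rw [hx]
  rcases eq_or_ne p 1 with rfl | hp1
  · have : q = ⊤ := ENNReal.HolderConjugate.unique 1 q ⊤
    subst this
    exact eLpNorm_one_le_of_test hf hC h
  have hq : q ≠ ⊤ := by
    rintro rfl
    exact hp1 (ENNReal.HolderConjugate.unique ⊤ p 1)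
  have hpq' : p.toReal.HolderConjugate q.toReal :=
    ENNReal.HolderConjugate.toReal_of_ne_top hp hq
  have hp0 : p ≠ 0 := (ENNReal.HolderConjugate.pos p q).ne'
  have hq0 : q ≠ 0 := (ENNReal.HolderConjugate.pos q p).ne'
  have main := lintegral_rpow_le_of_forall_lintegral_mul_le (μ := (volume : Measure (E N))) hpq'
    (f := fun x => ‖f x‖ₑ) hfm.measurable.enorm (C := ENNReal.ofReal C) ?_
  · rw [eLpNorm_eq_lintegral_rpow_enorm_toReal hp0 hp]
    calc _ ≤ (ENNReal.ofReal C ^ p.toReal) ^ (1 / p.toReal) :=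
          ENNReal.rpow_le_rpow main (by positivity)
      _ = ENNReal.ofReal C := by
          rw [← ENNReal.rpow_mul, mul_one_div_cancel hpq'.ne_zero, ENNReal.rpow_one]
  · intro g hg hgt
    have hgae : ∀ᵐ x ∂(volume : Measure (E N)), g x < ⊤ := by
      have := ae_lt_top (hg.pow_const q.toReal) hgt
      filter_upwards [this] with x hx
      exact (ENNReal.rpow_lt_top_iff_of_pos hpq'.symm.pos).1 hx
    -- Giving `g` the sign of `f` turns the signed pairing into `∫ |f| g`.
    set φ : E N → ℝ := fun x => if 0 ≤ f x then (g x).toReal else -(g x).toReal with hφ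
    have hφm : Measurable φ := Measurable.ite (measurableSet_le measurable_const hfm.measurable)
      hg.ennreal_toReal hg.ennreal_toReal.neg
    have hφa : ∀ x, |φ x| = (g x).toReal := fun x => by
      simp only [hφ]
      split_ifs <;> simp
    have hle : eLpNorm φ q volume ≤ (∫⁻ x, g x ^ q.toReal) ^ (1 / q.toReal) := by
      rw [eLpNorm_eq_lintegral_rpow_enorm_toReal hq0 hq]
      refine ENNReal.rpow_le_rpow (lintegral_mono fun x => ?_) (by positivity)
      refine ENNReal.rpow_le_rpow ?_ hpq'.symm.pos.le
      rw [Real.enorm_eq_ofReal_abs, hφa]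
      exact ENNReal.ofReal_toReal_le
    have hφL : MemLp φ q volume := ⟨hφm.aestronglyMeasurable, hle.trans_lt
      (ENNReal.rpow_lt_top_of_nonneg (by positivity) hgt)⟩
    have hI := integrable_mul_of_holderConjugate (q := q) hf hφL
    have e : ∫⁻ x, ‖f x‖ₑ * g x = ENNReal.ofReal (∫ x, f x * φ x) := by
      have hnn : ∀ x, f x * φ x = |f x| * (g x).toReal := by
        intro x
        simp only [hφ]
        split_ifs with h0
        · rw [abs_of_nonneg h0]
        · rw [abs_of_neg (not_le.1 h0)]; ring
      rw [ofReal_integral_eq_lintegral_ofReal hI (ae_of_all _ fun x => by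
        simp only [Pi.zero_apply, hnn]; positivity)]
      refine lintegral_congr_ae ?_
      filter_upwards [hgae] with x hx
      rw [hnn, ENNReal.ofReal_mul (abs_nonneg _), ENNReal.ofReal_toReal hx.ne,
        Real.enorm_eq_ofReal_abs]
    rw [e]
    calc _ ≤ ENNReal.ofReal (C * (eLpNorm φ q volume).toReal) :=
          ENNReal.ofReal_le_ofReal ((le_abs_self _).trans
            (abs_integral_mul_le_of_test hq hf hC h hφL))
      _ = ENNReal.ofReal C * eLpNorm φ q volume := by
          rw [ENNReal.ofReal_mul hC, ENNReal.ofReal_toReal hφL.2.ne]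
      _ ≤ _ := by gcongr

/-! ### Second differences -/

/-- The distributional second derivatives of `u` are bounded by `C` on the unit ball of `L^q`. -/
def HessBound (u : E N → ℝ) (q : ℝ≥0∞) (C : ℝ) : Prop :=
  ∀ φ : E N → ℝ, IsTest φ → ∀ k l,
    |∫ x, u x * pderiv k (pderiv l φ) x| ≤ C * (eLpNorm φ q volume).toReal

theorem memLp_secondDiff {u : E N → ℝ} {p : ℝ≥0∞} (hu : MemLp u p volume) (h : E N) :
    MemLp (secondDiff u h) p volume := by
  have h2 : MemLp (fun x => u (x - h)) p volume := by
    simpa [sub_eq_add_neg] using memLp_comp_add_right hu (-h)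
  exact ((memLp_comp_add_right hu h).sub (hu.const_mul 2)).add h2

theorem locallyIntegrable_of_memLp {u : E N → ℝ} {p q : ℝ≥0∞} [p.HolderConjugate q]
    (hu : MemLp u p volume) : LocallyIntegrable u volume :=
  hu.locallyIntegrable (ENNReal.HolderConjugate.one_le p q)

/-- Derivatives at `y` are the distributional derivatives tested on a translate of `φ`, and
translation preserves the `L^q` norm; hence uniformity in `y`. -/
theorem HessBound.abs_pderiv_corr_le {u : E N → ℝ} {q : ℝ≥0∞} {C : ℝ} (hB : HessBound u q C)
    (hu : LocallyIntegrable u volume) {φ : E N → ℝ} (hφ : IsTest φ) (k l : Fin N) (y : E N) :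
    |pderiv l (pderiv k (corr u φ)) y| ≤ C * (eLpNorm φ q volume).toReal := by
  rw [pderiv_corr hu hφ, pderiv_corr hu (hφ.pderiv k)]
  have h1 := hB _ (hφ.comp_add_right y) l k
  rw [pderiv_comp_add_right, pderiv_comp_add_right,
    eLpNorm_comp_add_right hφ.continuous.aestronglyMeasurable] at h1
  exact h1

theorem integral_sub_two_mul_add {a b c : E N → ℝ} (ha : Integrable a volume)
    (hb : Integrable b volume) (hc : Integrable c volume) :
    ∫ x, (a x - 2 * b x + c x) = (∫ x, a x) - 2 * (∫ x, b x) + ∫ x, c x := by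
  have h1 : ∫ x, (a x - 2 * b x + c x) = (∫ x, (a x - 2 * b x)) + ∫ x, c x :=
    integral_add (ha.sub (hb.const_mul 2)) hc
  rw [h1, integral_sub ha (hb.const_mul 2), integral_const_mul]

theorem integral_mul_secondDiff {u φ : E N → ℝ} {p q : ℝ≥0∞} [p.HolderConjugate q]
    (hu : MemLp u p volume) (hφ : MemLp φ q volume) (h : E N) :
    ∫ x, u x * secondDiff φ h x = secondDiff (corr u φ) h 0 := by
  have h1 := integrable_mul_of_holderConjugate hu (memLp_comp_add_right hφ h)
  have h2 := integrable_mul_of_holderConjugate hu hφ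
  have h3 := integrable_mul_of_holderConjugate hu (memLp_comp_add_right hφ (-h))
  have e : ∀ x, u x * secondDiff φ h x
      = u x * φ (x + h) - 2 * (u x * φ x) + u x * φ (x + -h) := by
    intro x; rw [secondDiff, ← sub_eq_add_neg]; ring
  simp only [e]
  rw [integral_sub_two_mul_add h1 h2 h3]
  simp [secondDiff, corr]

theorem integral_comp_add_mul (u φ : E N → ℝ) (h : E N) :
    ∫ x, u (x + h) * φ x = corr u φ (-h) := by
  rw [corr, ← integral_add_right_eq_self (fun x => u x * φ (x + -h)) h]
  simp

/-- The second difference is even in `h`, so moving it from `φ` to `u` leaves the value unchanged.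
This symmetry makes the pointwise and the distributional non-local Hessian agree. -/
theorem integral_secondDiff_mul {u φ : E N → ℝ} {p q : ℝ≥0∞} [p.HolderConjugate q]
    (hu : MemLp u p volume) (hφ : MemLp φ q volume) (h : E N) :
    ∫ x, secondDiff u h x * φ x = secondDiff (corr u φ) h 0 := by
  have h1 := integrable_mul_of_holderConjugate (memLp_comp_add_right hu h) hφ
  have h2 := integrable_mul_of_holderConjugate hu hφ
  have h3 := integrable_mul_of_holderConjugate (memLp_comp_add_right hu (-h)) hφ
  have e : ∀ x, secondDiff u h x * φ x
      = u (x + h) * φ x - 2 * (u x * φ x) + u (x + -h) * φ x := by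
    intro x; rw [secondDiff, ← sub_eq_add_neg]; ring
  simp only [e]
  rw [integral_sub_two_mul_add h1 h2 h3, integral_comp_add_mul, integral_comp_add_mul, ← corr_zero]
  simp [secondDiff]
  ring

/-- By duality it suffices to pair with test functions, and each pairing is a second difference at
`0` of a correlation with bounded second derivatives. -/
theorem HessBound.eLpNorm_secondDiff_le {u : E N → ℝ} {p q : ℝ≥0∞} [p.HolderConjugate q]
    (hp : p ≠ ⊤) {C : ℝ} (hC : 0 ≤ C) (hB : HessBound u q C) (hu : MemLp u p volume) (h : E N) :
    eLpNorm (secondDiff u h) p volume ≤ ENNReal.ofReal (2 * N ^ 2 * C * ‖h‖ ^ 2) := by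
  have hul := locallyIntegrable_of_memLp (q := q) hu
  refine eLpNorm_le_of_test (q := q) hp (memLp_secondDiff hu h) (by positivity) fun φ hφ => ?_
  rw [integral_secondDiff_mul (q := q) hu (hφ.memLp q)]
  refine (abs_secondDiff_le (corr_contDiff hul hφ)
    (fun k l y => hB.abs_pderiv_corr_le hul hφ k l y) h).trans (le_of_eq ?_)
  ring

theorem abs_corr_le {u φ : E N → ℝ} {p q : ℝ≥0∞} [p.HolderConjugate q] (hu : MemLp u p volume)
    (hφ : MemLp φ q volume) (y : E N) :
    |corr u φ y| ≤ (eLpNorm u p volume).toReal * (eLpNorm φ q volume).toReal := by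
  have := abs_integral_mul_le hu (memLp_comp_add_right hφ y)
  rwa [eLpNorm_comp_add_right hφ.1] at this

/-- The second order Taylor bound for test functions, integrated against a function in `L^p`. -/
theorem exists_integral_abs_mul_secondDiff_le {p q : ℝ≥0∞} [p.HolderConjugate q]
    {φ : E N → ℝ} (hφ : IsTest φ) {u : E N → ℝ} (hu : MemLp u p volume) :
    ∃ K : ℝ, 0 ≤ K ∧ (∀ h : E N, ∫ x, |u x * secondDiff φ h x| ≤ K * ‖h‖ ^ 2) ∧
      ∀ k l y, |pderiv l (pderiv k (corr u φ)) y| ≤ K := by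
  set M := (eLpNorm u p volume).toReal *
    ∑ k, ∑ l, (eLpNorm (pderiv l (pderiv k φ)) q volume).toReal with hM
  have hM0 : 0 ≤ M := by positivity
  -- The bound sees `u` only through its `L^p` norm, so it also holds for the rearranged signs used
  -- below.
  have hw : ∀ w : E N → ℝ, MemLp w p volume → eLpNorm w p volume = eLpNorm u p volume →
      ∀ k l y, |pderiv l (pderiv k (corr w φ)) y| ≤ M := by
    intro w hw hwu k l y
    have hwl := locallyIntegrable_of_memLp (q := q) hw
    rw [pderiv_corr hwl hφ, pderiv_corr hwl (hφ.pderiv k)]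
    refine (abs_corr_le hw (((hφ.pderiv k).pderiv l).memLp q) y).trans ?_
    rw [hwu, hM]
    refine mul_le_mul_of_nonneg_left ?_ ENNReal.toReal_nonneg
    calc _ ≤ ∑ l, (eLpNorm (NonlocalHessian.pderiv l (NonlocalHessian.pderiv k φ)) q
              volume).toReal :=
          Finset.single_le_sum (f := fun l => (eLpNorm (NonlocalHessian.pderiv l
            (NonlocalHessian.pderiv k φ)) q volume).toReal)
            (fun _ _ => ENNReal.toReal_nonneg) (Finset.mem_univ l)
      _ ≤ _ := Finset.single_le_sum (f := fun k => ∑ l, (eLpNorm (NonlocalHessian.pderiv l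
            (NonlocalHessian.pderiv k φ)) q volume).toReal)
            (fun _ _ => Finset.sum_nonneg fun _ _ => ENNReal.toReal_nonneg) (Finset.mem_univ k)
  refine ⟨max M (2 * N ^ 2 * M), le_max_of_le_left hM0, fun h => ?_,
    fun k l y => (hw u hu rfl k l y).trans (le_max_left _ _)⟩
  refine le_trans ?_ (mul_le_mul_of_nonneg_right (le_max_right _ _) (sq_nonneg _))
  have hsm : StronglyMeasurable (secondDiff φ h) := by
    have := hφ.continuous
    refine Continuous.stronglyMeasurable ?_
    unfold secondDiff
    fun_prop
  have hdm := memLp_secondDiff (hφ.memLp q) h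
  -- Giving `|u|` the sign of the second difference removes the absolute value inside the integral
  -- without changing the norm. The choice depends on `h`, but the bound does not.
  set w : E N → ℝ := fun x => if 0 ≤ secondDiff φ h x then 1 * |u x| else -1 * |u x| with hwd
  have hwn : ∀ x, ‖w x‖ = ‖u x‖ := fun x => by
    simp only [hwd]
    split_ifs <;> simp
  have hwm : AEStronglyMeasurable w volume :=
    by
    simp only [hwd, ← ite_mul]
    exact (Measurable.ite (measurableSet_le measurable_const hsm.measurable)
      measurable_const measurable_const).aestronglyMeasurable.mul hu.1.norm
  have hwL : MemLp w p volume := hu.of_le hwm (ae_of_all _ fun x => (hwn x).le)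
  have e : ∫ x, |u x * secondDiff φ h x| = ∫ x, w x * secondDiff φ h x := by
    congr 1
    funext x
    rw [abs_mul]
    simp only [hwd]
    split_ifs with h0
    · rw [abs_of_nonneg h0]; ring
    · rw [abs_of_neg (not_le.1 h0)]; ring
  rw [e, integral_mul_secondDiff (q := q) hwL (hφ.memLp q)]
  exact (le_abs_self _).trans
    (abs_secondDiff_le (corr_contDiff (locallyIntegrable_of_memLp (q := q) hwL) hφ)
      (hw w hwL (eLpNorm_congr_norm_ae (ae_of_all _ hwn))) h)

/-! ### Fubini for the non-local Hessian -/

theorem aestronglyMeasurable_nlHessian_integrand {ρ : E N → ℝ} (hρ : Integrable ρ volume)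
    {g : E N → ℝ} (hg : Measurable g) (i j : Fin N) :
    AEStronglyMeasurable (fun z : E N × E N =>
      secondDiff g z.2 z.1 / ‖z.2‖ ^ 2 * kern i j z.2 * ρ z.2) (volume.prod volume) := by
  have hk := measurable_kern (N := N) i j
  refine AEStronglyMeasurable.mul ?_ hρ.1.comp_snd
  refine Measurable.aestronglyMeasurable ?_
  unfold secondDiff
  fun_prop

theorem abs_nlHessian_integrand_le {ρ : E N → ℝ} (hρ : ∀ h, 0 ≤ ρ h) (a : ℝ) (h : E N)
    (i j : Fin N) : |a / ‖h‖ ^ 2 * kern i j h * ρ h| ≤ 2 * (|a| / ‖h‖ ^ 2) * ρ h := by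
  rw [abs_mul, abs_mul, abs_div, abs_of_nonneg (hρ h), abs_of_nonneg (sq_nonneg ‖h‖)]
  refine mul_le_mul_of_nonneg_right ?_ (hρ h)
  rw [mul_comm]
  exact mul_le_mul_of_nonneg_right (abs_kern_le i j h) (by positivity)

/-- Pairing the non-local Hessian of `g` with `f`. -/
theorem integral_mul_nlHessian {ρ : E N → ℝ} (hρ : Integrable ρ volume) (hρ0 : ∀ h, 0 ≤ ρ h)
    {f g : E N → ℝ} (hf : AEStronglyMeasurable f volume) (hg : Measurable g)
    (hi : ∀ h, Integrable (fun x => f x * secondDiff g h x) volume) {K : ℝ}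
    (hK : ∀ h : E N, ∫ x, |f x * secondDiff g h x| ≤ K * ‖h‖ ^ 2) (i j : Fin N) :
    ∫ x, f x * nlHessian ρ g x i j = (N * (N + 2) / 2 : ℝ) *
      ∫ h, (∫ x, f x * secondDiff g h x) / ‖h‖ ^ 2 * kern i j h * ρ h := by
  set F : E N → E N → ℝ := fun x h =>
    f x * (secondDiff g h x / ‖h‖ ^ 2 * kern i j h * ρ h) with hF
  have hFm : AEStronglyMeasurable (Function.uncurry F) (volume.prod volume) :=
    hf.comp_fst.mul (aestronglyMeasurable_nlHessian_integrand hρ hg i j)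
  have hFe : ∀ x h, F x h = (f x * secondDiff g h x) * (1 / ‖h‖ ^ 2 * kern i j h * ρ h) := by
    intro x h; simp only [hF]; ring
  have hFi : Integrable (Function.uncurry F) (volume.prod volume) := by
    rw [integrable_prod_iff' hFm]
    refine ⟨ae_of_all _ fun h => ?_, ?_⟩
    · simp only [Function.uncurry_apply_pair, hFe]
      exact (hi h).mul_const _
    -- The factor `|h|²` from `hK` absorbs the singularity of the kernel, leaving an integrable
    -- multiple of `ρ`.
    · refine (hρ.const_mul (2 * |K|)).mono' hFm.norm.prod_swap.integral_prod_right' ?_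
      refine ae_of_all _ fun h => ?_
      have h1 : ∀ x, ‖Function.uncurry F (x, h)‖
          = |f x * secondDiff g h x| * |1 / ‖h‖ ^ 2 * kern i j h * ρ h| := fun x => by
        simp only [Function.uncurry_apply_pair, hFe]
        rw [Real.norm_eq_abs, abs_mul]
      simp only [h1]
      rw [integral_mul_const, Real.norm_eq_abs, abs_mul, abs_abs,
        abs_of_nonneg (integral_nonneg fun x => abs_nonneg _)]
      have h2 := abs_nlHessian_integrand_le hρ0 1 h i j
      calc _ ≤ (K * ‖h‖ ^ 2) * (2 * (|1| / ‖h‖ ^ 2) * ρ h) :=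
            mul_le_mul (hK h) h2 (abs_nonneg _)
              ((integral_nonneg fun x => abs_nonneg _).trans (hK h))
        _ ≤ 2 * |K| * ρ h := by
          have h3 : ‖h‖ ^ 2 * (1 / ‖h‖ ^ 2) ≤ 1 := by
            rw [mul_one_div]; exact div_self_le_one _
          have h4 : 0 ≤ ‖h‖ ^ 2 * (1 / ‖h‖ ^ 2) := by positivity
          have h5 : K * (‖h‖ ^ 2 * (1 / ‖h‖ ^ 2)) ≤ |K| := by
            calc _ ≤ |K| * (‖h‖ ^ 2 * (1 / ‖h‖ ^ 2)) :=
                  mul_le_mul_of_nonneg_right (le_abs_self K) h4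
              _ ≤ |K| := mul_le_of_le_one_right (abs_nonneg K) h3
          have := mul_le_mul_of_nonneg_right h5 (hρ0 h)
          rw [abs_one]
          nlinarith
  have hswap := integral_integral_swap hFi
  have e1 : ∀ x, f x * nlHessian ρ g x i j = (N * (N + 2) / 2 : ℝ) * ∫ h, F x h := by
    intro x
    rw [nlHessian_eq]
    simp only [hF]
    rw [integral_const_mul]
    ring
  simp only [e1]
  rw [integral_const_mul, hswap]
  congr 2
  funext h
  simp only [hFe]
  rw [integral_mul_const]
  ring

/-- The distributional non-local Hessian in terms of the correlation of `u` and `φ`. -/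
theorem distNlHessian_eq {ρ : E N → ℝ} (hρ : Integrable ρ volume) (hρ0 : ∀ h, 0 ≤ ρ h)
    {p q : ℝ≥0∞} [p.HolderConjugate q] {u : E N → ℝ} (hu : MemLp u p volume) {φ : E N → ℝ}
    (hφ : IsTest φ) (i j : Fin N) :
    distNlHessian ρ u i j φ = nlHessian ρ (corr u φ) 0 i j := by
  obtain ⟨K, -, hK, -⟩ := exists_integral_abs_mul_secondDiff_le (q := q) hφ hu
  rw [distNlHessian, integral_mul_nlHessian hρ hρ0 hu.1 hφ.continuous.measurable
    (fun h => integrable_mul_of_holderConjugate (q := q) hu (memLp_secondDiff (hφ.memLp q) h)) hK,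
    nlHessian_eq]
  simp only [integral_mul_secondDiff (q := q) hu (hφ.memLp q)]

/-- Fubini with the roles of `u` and `φ` exchanged. The right-hand side is also the value of the
distribution, so the pointwise integral represents it. -/
theorem HessBound.integral_mul_nlHessian_eq {ρ : E N → ℝ} (hρ : Integrable ρ volume)
    (hρ0 : ∀ h, 0 ≤ ρ h) {p q : ℝ≥0∞} [p.HolderConjugate q] (hp : p ≠ ⊤) {u : E N → ℝ} {C : ℝ}
    (hC : 0 ≤ C) (hB : HessBound u q C) (hu : MemLp u p volume) (hum : Measurable u) {φ : E N → ℝ}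
    (hφ : IsTest φ) (i j : Fin N) :
    ∫ x, nlHessian ρ u x i j * φ x = nlHessian ρ (corr u φ) 0 i j := by
  have hi : ∀ h, Integrable (fun x => φ x * secondDiff u h x) volume := fun h =>
    integrable_mul_of_holderConjugate (p := q) (q := p) (hφ.memLp q) (memLp_secondDiff hu h)
  have hK : ∀ h : E N, ∫ x, |φ x * secondDiff u h x|
      ≤ ((eLpNorm φ q volume).toReal * (2 * N ^ 2 * C)) * ‖h‖ ^ 2 := by
    intro h
    refine (integral_abs_mul_le (p := q) (q := p) (hφ.memLp q) (memLp_secondDiff hu h)).trans ?_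
    rw [mul_assoc]
    refine mul_le_mul_of_nonneg_left ?_ ENNReal.toReal_nonneg
    exact ENNReal.toReal_le_of_le_ofReal (by positivity) (hB.eLpNorm_secondDiff_le hp hC hu h)
  simp only [mul_comm _ (φ _)]
  rw [integral_mul_nlHessian hρ hρ0 hφ.continuous.aestronglyMeasurable hum hi hK, nlHessian_eq]
  simp only [mul_comm (φ _), integral_secondDiff_mul (q := q) hu (hφ.memLp q)]

/-! ### Bounds on the non-local energy -/

theorem lintegral_rpow_le_of_isProbabilityMeasure {α : Type*} [MeasurableSpace α] {μ : Measure α}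
    [IsProbabilityMeasure μ] {f : α → ℝ≥0∞} (hf : Measurable f) {p : ℝ} (hp : 1 ≤ p) :
    (∫⁻ x, f x ∂μ) ^ p ≤ ∫⁻ x, f x ^ p ∂μ := by
  have h := eLpNorm'_le_eLpNorm'_of_exponent_le zero_lt_one hp μ hf.aestronglyMeasurable
  simp only [eLpNorm'_eq_lintegral_enorm, enorm_eq_self, ENNReal.rpow_one, div_one] at h
  have hp0 : 0 < p := by linarith
  calc _ ≤ ((∫⁻ x, f x ^ p ∂μ) ^ (1 / p)) ^ p := ENNReal.rpow_le_rpow h hp0.le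
    _ = _ := by rw [← ENNReal.rpow_mul, one_div_mul_cancel hp0.ne', ENNReal.rpow_one]

/-- Averages of a family of functions bounded in `L^p`. -/
theorem lintegral_lintegral_rpow_le {α β : Type*} [MeasurableSpace α] [MeasurableSpace β]
    {μ : Measure α} [SFinite μ] {ν : Measure β} [IsProbabilityMeasure ν] {f : α → β → ℝ≥0∞}
    (hf : Measurable (Function.uncurry f)) {p : ℝ} (hp : 1 ≤ p) {K : ℝ≥0∞}
    (hK : ∀ y, ∫⁻ x, f x y ^ p ∂μ ≤ K) : ∫⁻ x, (∫⁻ y, f x y ∂ν) ^ p ∂μ ≤ K := by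
  calc ∫⁻ x, (∫⁻ y, f x y ∂ν) ^ p ∂μ ≤ ∫⁻ x, ∫⁻ y, f x y ^ p ∂ν ∂μ :=
        lintegral_mono fun x =>
          lintegral_rpow_le_of_isProbabilityMeasure (hf.comp measurable_prodMk_left) hp
    _ = ∫⁻ y, ∫⁻ x, f x y ^ p ∂μ ∂ν := lintegral_lintegral_swap (hf.pow_const p).aemeasurable
    _ ≤ ∫⁻ y, K ∂ν := lintegral_mono hK
    _ = K := by simp

theorem aestronglyMeasurable_nlHessian {ρ : E N → ℝ} (hρ : Integrable ρ volume)
    {u : E N → ℝ} (hu : Measurable u) (i j : Fin N) :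
    AEStronglyMeasurable (fun x => nlHessian ρ u x i j) volume :=
  (aestronglyMeasurable_nlHessian_integrand hρ hu i j).integral_prod_right'.const_mul _

theorem lintegral_withDensity_ofReal {ρ : E N → ℝ} (hρ : Integrable ρ volume) {g : E N → ℝ≥0∞}
    (hg : Measurable g) :
    ∫⁻ h, g h ∂(volume.withDensity fun h => ENNReal.ofReal (ρ h))
      = ∫⁻ h, ENNReal.ofReal (ρ h) * g h :=
  lintegral_withDensity_eq_lintegral_mul₀ hρ.1.aemeasurable.ennreal_ofReal hg.aemeasurable

/-- The non-local Hessian is dominated by an average, over the probability measure with density `ρ`,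
of `|h|⁻²` times second differences. These quotients are bounded in `L^p` uniformly in `h`, and
averaging preserves the bound. -/
theorem HessBound.eLpNorm_nlHessian_le {ρ : E N → ℝ} (h1 : ∫ x, ρ x = 1)
    (hρ0 : ∀ h, 0 ≤ ρ h) {p : ℝ} (hp : 1 ≤ p) {q : ℝ≥0∞} [(ENNReal.ofReal p).HolderConjugate q]
    {u : E N → ℝ} {C : ℝ} (hC : 0 ≤ C) (hB : HessBound u q C)
    (hu : MemLp u (ENNReal.ofReal p) volume) (hum : Measurable u) (i j : Fin N) :
    eLpNorm (fun x => nlHessian ρ u x i j) (ENNReal.ofReal p) volume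
      ≤ ENNReal.ofReal (N * (N + 2) / 2 * (2 * (2 * N ^ 2 * C))) := by
  have hρ := integrable_of_integral_eq_one h1
  have hp0 : 0 < p := by linarith
  have hP0 : ENNReal.ofReal p ≠ 0 := by simpa using hp0
  set ν : Measure (E N) := volume.withDensity fun h => ENNReal.ofReal (ρ h) with hν
  have hνp : IsProbabilityMeasure ν := ⟨by
    rw [hν, withDensity_apply _ MeasurableSet.univ, Measure.restrict_univ,
      ← ofReal_integral_eq_lintegral_ofReal hρ (ae_of_all _ hρ0), h1, ENNReal.ofReal_one]⟩
  -- The factor `2` is the bound on `kern`.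
  set f : E N → E N → ℝ≥0∞ := fun x h => ‖2 * (secondDiff u h x / ‖h‖ ^ 2)‖ₑ with hf
  have hfm : Measurable (Function.uncurry f) := by
    have : Measurable fun z : E N × E N => 2 * (secondDiff u z.2 z.1 / ‖z.2‖ ^ 2) := by
      unfold secondDiff
      fun_prop
    exact this.enorm
  have hfK : ∀ h, ∫⁻ x, f x h ^ p ≤ ENNReal.ofReal (2 * (2 * N ^ 2 * C)) ^ p := by
    intro h
    have hb : eLpNorm (fun x => 2 * (secondDiff u h x / ‖h‖ ^ 2)) (ENNReal.ofReal p) volume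
        ≤ ENNReal.ofReal (2 * (2 * N ^ 2 * C)) := by
      have e : (fun x => 2 * (secondDiff u h x / ‖h‖ ^ 2)) = (2 / ‖h‖ ^ 2) • secondDiff u h := by
        funext x
        simp only [Pi.smul_apply, smul_eq_mul]
        ring
      rw [e, eLpNorm_const_smul]
      refine (mul_le_mul_right (hB.eLpNorm_secondDiff_le (by simp) hC hu h) _).trans ?_
      rw [Real.enorm_eq_ofReal_abs, ← ENNReal.ofReal_mul (abs_nonneg _)]
      refine ENNReal.ofReal_le_ofReal ?_
      rw [abs_of_nonneg (by positivity)]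
      have : ‖h‖ ^ 2 / ‖h‖ ^ 2 ≤ 1 := div_self_le_one _
      calc 2 / ‖h‖ ^ 2 * (2 * N ^ 2 * C * ‖h‖ ^ 2)
          = (2 * (2 * N ^ 2 * C)) * (‖h‖ ^ 2 / ‖h‖ ^ 2) := by ring
        _ ≤ _ := mul_le_of_le_one_right (by positivity) this
    rw [eLpNorm_eq_lintegral_rpow_enorm_toReal hP0 (by simp), ENNReal.toReal_ofReal hp0.le] at hb
    calc _ = ((∫⁻ x, f x h ^ p) ^ (1 / p)) ^ p := by
          rw [← ENNReal.rpow_mul, one_div_mul_cancel hp0.ne', ENNReal.rpow_one]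
      _ ≤ _ := ENNReal.rpow_le_rpow hb hp0.le
  have hle : ∀ x, ‖nlHessian ρ u x i j‖ₑ
      ≤ ENNReal.ofReal (N * (N + 2) / 2) * ∫⁻ h, f x h ∂ν := by
    intro x
    rw [nlHessian_eq, enorm_mul, Real.enorm_eq_ofReal_abs, abs_of_nonneg (by positivity)]
    refine mul_le_mul_right ((enorm_integral_le_lintegral_enorm _).trans ?_) _
    rw [hν, lintegral_withDensity_ofReal hρ hfm.of_uncurry_left]
    refine lintegral_mono fun h => ?_
    simp only [hf, Real.enorm_eq_ofReal_abs]
    rw [← ENNReal.ofReal_mul (hρ0 h)]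
    refine ENNReal.ofReal_le_ofReal ?_
    refine (abs_nlHessian_integrand_le hρ0 _ h i j).trans (le_of_eq ?_)
    rw [abs_mul, abs_div, abs_of_nonneg (sq_nonneg ‖h‖), abs_two]
    ring
  rw [eLpNorm_eq_lintegral_rpow_enorm_toReal hP0 (by simp), ENNReal.toReal_ofReal hp0.le]
  have hI : ∫⁻ x, ‖nlHessian ρ u x i j‖ₑ ^ p
      ≤ ENNReal.ofReal (N * (N + 2) / 2 * (2 * (2 * N ^ 2 * C))) ^ p := by
    calc _ ≤ ∫⁻ x, ENNReal.ofReal (N * (N + 2) / 2) ^ p * (∫⁻ h, f x h ∂ν) ^ p :=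
          lintegral_mono fun x => by
            rw [← ENNReal.mul_rpow_of_nonneg _ _ hp0.le]
            exact ENNReal.rpow_le_rpow (hle x) hp0.le
      _ = ENNReal.ofReal (N * (N + 2) / 2) ^ p * ∫⁻ x, (∫⁻ h, f x h ∂ν) ^ p :=
          lintegral_const_mul' _ _ (ENNReal.rpow_ne_top_of_nonneg hp0.le ENNReal.ofReal_ne_top)
      _ ≤ ENNReal.ofReal (N * (N + 2) / 2) ^ p * ENNReal.ofReal (2 * (2 * N ^ 2 * C)) ^ p :=
          mul_le_mul_right (lintegral_lintegral_rpow_le hfm hp hfK) _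
      _ = _ := by
          rw [← ENNReal.mul_rpow_of_nonneg _ _ hp0.le, ← ENNReal.ofReal_mul (by positivity)]
  calc _ ≤ (ENNReal.ofReal (N * (N + 2) / 2 * (2 * (2 * N ^ 2 * C))) ^ p) ^ (1 / p) :=
        ENNReal.rpow_le_rpow hI (by positivity)
    _ = _ := by rw [← ENNReal.rpow_mul, mul_one_div_cancel hp0.ne', ENNReal.rpow_one]

/-! ### Frobenius norms and the energy bound -/

theorem frob_nonneg (A : Matrix (Fin N) (Fin N) ℝ) : 0 ≤ frob A := Real.sqrt_nonneg _

theorem abs_le_frob (A : Matrix (Fin N) (Fin N) ℝ) (i j : Fin N) : |A i j| ≤ frob A := by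
  rw [frob, ← Real.sqrt_sq_eq_abs]
  refine Real.sqrt_le_sqrt ?_
  calc A i j ^ 2 ≤ ∑ j, A i j ^ 2 :=
        Finset.single_le_sum (f := fun j => A i j ^ 2) (fun _ _ => sq_nonneg _) (Finset.mem_univ j)
    _ ≤ _ := Finset.single_le_sum (f := fun i => ∑ j, A i j ^ 2)
        (fun _ _ => Finset.sum_nonneg fun _ _ => sq_nonneg _) (Finset.mem_univ i)

theorem frob_le_sum (A : Matrix (Fin N) (Fin N) ℝ) : frob A ≤ ∑ i, ∑ j, |A i j| := by
  rw [frob]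
  refine Real.sqrt_le_iff.2 ⟨by positivity, ?_⟩
  calc ∑ i, ∑ j, A i j ^ 2 ≤ ∑ i, (∑ j, |A i j|) ^ 2 := by
        refine Finset.sum_le_sum fun i _ => ?_
        simpa only [sq_abs] using Finset.sum_sq_le_sq_sum_of_nonneg
          (s := Finset.univ) (f := fun j => |A i j|) fun _ _ => abs_nonneg _
    _ ≤ _ := Finset.sum_sq_le_sq_sum_of_nonneg (s := Finset.univ) (f := fun i => ∑ j, |A i j|)
        fun _ _ => Finset.sum_nonneg fun _ _ => abs_nonneg _

theorem lintegral_frob_rpow_eq (v : E N → Matrix (Fin N) (Fin N) ℝ) {p : ℝ} (hp : 0 < p) :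
    ∫⁻ x, ENNReal.ofReal (frob (v x) ^ p)
      = eLpNorm (fun x => frob (v x)) (ENNReal.ofReal p) volume ^ p := by
  rw [eLpNorm_eq_lintegral_rpow_enorm_toReal (by simpa using hp) (by simp),
    ENNReal.toReal_ofReal hp.le, ← ENNReal.rpow_mul, one_div_mul_cancel hp.ne', ENNReal.rpow_one]
  refine lintegral_congr fun x => ?_
  have h0 : 0 ≤ frob (v x) := frob_nonneg _
  rw [← ENNReal.ofReal_rpow_of_nonneg h0 hp.le, Real.enorm_eq_ofReal_abs, abs_of_nonneg h0]

theorem eLpNorm_frob_le {v : E N → Matrix (Fin N) (Fin N) ℝ} {P : ℝ≥0∞} (hP : 1 ≤ P)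
    (hm : ∀ i j, AEStronglyMeasurable (fun x => v x i j) volume) {K : ℝ≥0∞}
    (hK : ∀ i j, eLpNorm (fun x => v x i j) P volume ≤ K) :
    eLpNorm (fun x => frob (v x)) P volume ≤ N * (N * K) := by
  have h1 : eLpNorm (fun x => frob (v x)) P volume
      ≤ eLpNorm (∑ i, ∑ j, fun x => |v x i j|) P volume := by
    refine eLpNorm_mono_real fun x => ?_
    rw [Real.norm_eq_abs, abs_of_nonneg (frob_nonneg _)]
    simpa only [Finset.sum_apply] using frob_le_sum (v x)
  have hm' : ∀ i j, AEStronglyMeasurable (fun x => |v x i j|) volume := fun i j => (hm i j).norm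
  refine h1.trans ((eLpNorm_sum_le (fun i _ => Finset.aestronglyMeasurable_sum _
    fun j _ => hm' i j) hP).trans ?_)
  calc _ ≤ ∑ i : Fin N, ∑ j : Fin N, K := by
        refine Finset.sum_le_sum fun i _ => (eLpNorm_sum_le (fun j _ => hm' i j) hP).trans ?_
        refine Finset.sum_le_sum fun j _ => le_trans (le_of_eq ?_) (hK i j)
        exact eLpNorm_norm (fun x => v x i j)
    _ = _ := by simp

theorem nlEnergy_congr_ae {ρ u u' : E N → ℝ} (p : ℝ) (h : u =ᵐ[volume] u') :
    nlEnergy ρ p u = nlEnergy ρ p u' := by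
  have e : ∀ i j φ, distNlHessian ρ u i j φ = distNlHessian ρ u' i j φ := fun i j φ =>
    integral_congr_ae (h.mono fun x hx => congrArg (· * nlHessian ρ φ x i j) hx)
  simp only [nlEnergy, IsDistNlHessian, e]

theorem HessBound.congr_ae {u u' : E N → ℝ} {q : ℝ≥0∞} {C : ℝ} (hB : HessBound u q C)
    (h : u =ᵐ[volume] u') : HessBound u' q C := fun φ hφ k l => by
  rw [← integral_congr_ae (h.mono fun x hx => by
    show u x * NonlocalHessian.pderiv k (NonlocalHessian.pderiv l φ) x = u' x * _; rw [hx])]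
  exact hB φ hφ k l

/-- Functions with bounded distributional second derivatives have bounded non-local energies. -/
theorem HessBound.nlEnergy_le {ρ : E N → ℝ} (h1 : ∫ x, ρ x = 1) (hρ0 : ∀ h, 0 ≤ ρ h) {p : ℝ}
    (hp : 1 ≤ p) {q : ℝ≥0∞} [(ENNReal.ofReal p).HolderConjugate q]
    {u : E N → ℝ} {C : ℝ} (hC : 0 ≤ C) (hB : HessBound u q C)
    (hu : MemLp u (ENNReal.ofReal p) volume) :
    nlEnergy ρ p u
      ≤ (N * (N * ENNReal.ofReal (N * (N + 2) / 2 * (2 * (2 * N ^ 2 * C))))) ^ p := by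
  -- The joint measurability of `u (x + h)` in the Fubini arguments is read off from a measurable
  -- representative.
  wlog hum : StronglyMeasurable u generalizing u
  · rw [nlEnergy_congr_ae p hu.1.ae_eq_mk]
    exact this (hB.congr_ae hu.1.ae_eq_mk) ((memLp_congr_ae hu.1.ae_eq_mk).1 hu)
      hu.1.stronglyMeasurable_mk
  have hρ := integrable_of_integral_eq_one h1
  have hp0 : 0 < p := by linarith
  have hm := aestronglyMeasurable_nlHessian hρ hum.measurable
  have hle := hB.eLpNorm_nlHessian_le h1 hρ0 hp hC hu hum.measurable
  have hv : IsDistNlHessian ρ u (nlHessian ρ u) := fun i j =>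
    ⟨locallyIntegrable_of_memLp (p := ENNReal.ofReal p) (q := q)
      ⟨hm i j, (hle i j).trans_lt ENNReal.ofReal_lt_top⟩, fun φ hφ => by
      rw [distNlHessian_eq (q := q) hρ hρ0 hu hφ,
        hB.integral_mul_nlHessian_eq hρ hρ0 (by simp) hC hu hum.measurable hφ]⟩
  rw [nlEnergy_eq p hv, lintegral_frob_rpow_eq _ hp0]
  exact ENNReal.rpow_le_rpow (eLpNorm_frob_le (by simpa using hp) hm hle) hp0.le

/-! ### First derivatives -/

/-- The pairing with the difference quotient is a difference quotient of the correlation between `0`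
and `-t e_i`; Taylor gives an error linear in `t`. -/
theorem HessBound.abs_integral_sub_mul_le {u : E N → ℝ} {p q : ℝ≥0∞} [p.HolderConjugate q]
    {C : ℝ} (hB : HessBound u q C) (hu : MemLp u p volume) {φ : E N → ℝ} (hφ : IsTest φ)
    (i : Fin N) {t : ℝ} (ht : 0 < t) :
    |(∫ x, t⁻¹ * (u (x + t • EuclideanSpace.single i 1) - u x) * φ x)
      + ∫ x, u x * pderiv i φ x| ≤ t * (C * (eLpNorm φ q volume).toReal) := by
  have hul := locallyIntegrable_of_memLp (q := q) hu
  set e : E N := EuclideanSpace.single i 1 with he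
  have h1 : ∫ x, t⁻¹ * (u (x + t • e) - u x) * φ x
      = t⁻¹ * (corr u φ ((-t) • e) - corr u φ 0) := by
    have i1 := integrable_mul_of_holderConjugate (memLp_comp_add_right hu (t • e)) (hφ.memLp q)
    have i2 := integrable_mul_of_holderConjugate hu (hφ.memLp q)
    rw [neg_smul, ← integral_comp_add_mul, corr_zero, ← integral_sub i1 i2,
      ← integral_const_mul]
    congr 1
    funext x
    ring
  have h2 : ∫ x, u x * NonlocalHessian.pderiv i φ x
      = NonlocalHessian.pderiv i (corr u φ) 0 := by
    rw [pderiv_corr hul hφ, corr_zero]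
  have h3 := abs_sub_sub_pderiv_le (corr_contDiff hul hφ) i
    (fun y => hB.abs_pderiv_corr_le hul hφ i i y) (-t)
  rw [h1, h2]
  have h4 : t⁻¹ * (corr u φ ((-t) • e) - corr u φ 0) + NonlocalHessian.pderiv i (corr u φ) 0
      = t⁻¹ * (corr u φ ((-t) • e) - corr u φ 0 - -t * NonlocalHessian.pderiv i (corr u φ) 0) := by
    field_simp
    ring
  rw [h4, abs_mul, abs_of_pos (inv_pos.2 ht)]
  calc _ ≤ t⁻¹ * ((-t) ^ 2 * (C * (eLpNorm φ q volume).toReal)) :=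
        mul_le_mul_of_nonneg_left h3 (inv_pos.2 ht).le
    _ = _ := by field_simp

/-- A function in `L^p` with bounded distributional second derivatives has weak first derivatives
in `L^p`. -/
theorem HessBound.exists_hasWeakPartial {u : E N → ℝ} {p q : ℝ≥0∞} [p.HolderConjugate q]
    (hp : p ≠ ⊤) {C : ℝ} (hC : 0 ≤ C) (hB : HessBound u q C) (hu : MemLp u p volume)
    (i : Fin N) : ∃ v, HasWeakPartial i u v ∧ MemLp v p volume := by
  have hp1 : 1 ≤ p := ENNReal.HolderConjugate.one_le p q
  have : Fact (1 ≤ p) := ⟨hp1⟩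
  set t : ℕ → ℝ := fun n => 1 / ((n : ℝ) + 1) with ht
  have ht0 : ∀ n, 0 < t n := fun n => by positivity
  have htlim : Tendsto t atTop (𝓝 0) := tendsto_one_div_add_atTop_nhds_zero_nat
  set d : ℕ → E N → ℝ := fun n x =>
    (t n)⁻¹ * (u (x + t n • EuclideanSpace.single i 1) - u x) with hd
  have hdL : ∀ n, MemLp (d n) p volume := fun n =>
    ((memLp_comp_add_right hu _).sub hu).const_mul _
  -- The quotients share the same distributional limit with explicit rates, so duality makes them
  -- Cauchy in norm. Weak compactness would yield only a measure when `p = 1`.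
  have hdd : ∀ n m, eLpNorm (d n - d m) p volume ≤ ENNReal.ofReal ((t n + t m) * C) := by
    intro n m
    refine eLpNorm_le_of_test (q := q) hp ((hdL n).sub (hdL m))
      (mul_nonneg (add_nonneg (ht0 n).le (ht0 m).le) hC) fun φ hφ => ?_
    have hn := abs_le.1 (hB.abs_integral_sub_mul_le hu hφ i (ht0 n))
    have hm := abs_le.1 (hB.abs_integral_sub_mul_le hu hφ i (ht0 m))
    have e : ∫ x, (d n - d m) x * φ x = (∫ x, d n x * φ x) - ∫ x, d m x * φ x := by
      rw [← integral_sub (integrable_mul_of_holderConjugate (hdL n) (hφ.memLp q))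
        (integrable_mul_of_holderConjugate (hdL m) (hφ.memLp q))]
      congr 1; funext x; simp only [Pi.sub_apply]; ring
    rw [e, abs_le]
    simp only [hd]
    constructor <;> nlinarith [hn.1, hn.2, hm.1, hm.2]
  set D : ℕ → Lp ℝ p (volume : Measure (E N)) := fun n => (hdL n).toLp with hD
  have hcau : CauchySeq D := by
    rw [Metric.cauchySeq_iff']
    intro ε hε
    obtain ⟨n₀, hn₀⟩ := (htlim.eventually (Iio_mem_nhds
      (by positivity : 0 < ε / (2 * (C + 1))))).exists_forall_of_atTop
    refine ⟨n₀, fun n hn => ?_⟩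
    rw [Lp.dist_def]
    have h1 : eLpNorm (⇑(D n) - ⇑(D n₀)) p volume ≤ ENNReal.ofReal ((t n + t n₀) * C) := by
      refine le_trans (le_of_eq (eLpNorm_congr_ae ?_)) (hdd n n₀)
      exact (hdL n).coeFn_toLp.sub (hdL n₀).coeFn_toLp
    have h2 := ENNReal.toReal_le_of_le_ofReal
      (mul_nonneg (add_nonneg (ht0 n).le (ht0 n₀).le) hC) h1
    refine h2.trans_lt ?_
    have h3 : t n + t n₀ < 2 * (ε / (2 * (C + 1))) := by
      have a1 : t n < ε / (2 * (C + 1)) := hn₀ n hn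
      have a2 : t n₀ < ε / (2 * (C + 1)) := hn₀ n₀ le_rfl
      linarith
    calc (t n + t n₀) * C ≤ 2 * (ε / (2 * (C + 1))) * C := mul_le_mul_of_nonneg_right h3.le hC
      _ < ε := by
        have : 2 * (ε / (2 * (C + 1))) * C = ε * (C / (C + 1)) := by field_simp
        rw [this]
        exact mul_lt_of_lt_one_right hε ((div_lt_one (by positivity)).2 (by linarith))
  obtain ⟨v, hv⟩ := cauchySeq_tendsto_of_complete hcau
  refine ⟨v, ⟨locallyIntegrable_of_memLp (q := q) hu,
    locallyIntegrable_of_memLp (q := q) (Lp.memLp v), fun φ hφ => ?_⟩, Lp.memLp v⟩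
  have hφq := hφ.memLp q
  have hlim1 : Tendsto (fun n => ∫ x, d n x * φ x) atTop (𝓝 (∫ x, v x * φ x)) := by
    rw [tendsto_iff_norm_sub_tendsto_zero]
    have h0 : Tendsto (fun n => dist (D n) v * (eLpNorm φ q volume).toReal) atTop (𝓝 0) := by
      simpa using (tendsto_iff_dist_tendsto_zero.1 hv).mul_const (eLpNorm φ q volume).toReal
    refine squeeze_zero (fun n => norm_nonneg _) (fun n => ?_) h0
    have e : (∫ x, d n x * φ x) - ∫ x, v x * φ x = ∫ x, (d n - v) x * φ x := by
      rw [← integral_sub (integrable_mul_of_holderConjugate (hdL n) hφq)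
        (integrable_mul_of_holderConjugate (Lp.memLp v) hφq)]
      congr 1; funext x; simp only [Pi.sub_apply]; ring
    rw [e, Lp.dist_def]
    refine (abs_integral_mul_le ((hdL n).sub (Lp.memLp v)) hφq).trans (le_of_eq ?_)
    congr 2
    exact eLpNorm_congr_ae ((hdL n).coeFn_toLp.symm.sub EventuallyEq.rfl)
  have hlim2 : Tendsto (fun n => ∫ x, d n x * φ x) atTop
      (𝓝 (-∫ x, u x * NonlocalHessian.pderiv i φ x)) := by
    rw [tendsto_iff_norm_sub_tendsto_zero]
    have h0 : Tendsto (fun n => t n * (C * (eLpNorm φ q volume).toReal)) atTop (𝓝 0) := by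
      simpa using htlim.mul_const (C * (eLpNorm φ q volume).toReal)
    refine squeeze_zero (fun n => norm_nonneg _) (fun n => ?_) h0
    rw [sub_neg_eq_add]
    exact hB.abs_integral_sub_mul_le hu hφ i (ht0 n)
  rw [tendsto_nhds_unique hlim1 hlim2, neg_neg]

/-! ### Weak limits of bounded sequences -/

/-- Compactness along an ultrafilter handles all test functions at once, with no diagonal
extraction. -/
theorem exists_tendsto_ultrafilter (U : Ultrafilter ℕ) {a : ℕ → ℝ} {B : ℝ} (hB : ∀ n, |a n| ≤ B) :
    ∃ l, Tendsto a U (𝓝 l) := by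
  obtain ⟨l, -, hl⟩ := (isCompact_Icc (a := -B) (b := B)).ultrafilter_le_nhds (U.map a)
    (le_principal_iff.2 (eventually_map.2 (Eventually.of_forall fun n => abs_le.1 (hB n))))
  exact ⟨l, hl⟩

open CompactlySupported in
/-- Weak limits along an ultrafilter of nonnegative functions bounded in `L^p`. -/
theorem exists_regular_tendsto (U : Ultrafilter ℕ) {p q : ℝ≥0∞} [p.HolderConjugate q]
    {f : ℕ → E N → ℝ} (hf : ∀ n, MemLp (f n) p volume) (h0 : ∀ n x, 0 ≤ f n x) {K : ℝ}
    (hK0 : 0 ≤ K) (hK : ∀ n, eLpNorm (f n) p volume ≤ ENNReal.ofReal K) :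
    ∃ μ : Measure (E N), μ.Regular ∧ ∀ φ : E N → ℝ, Continuous φ → HasCompactSupport φ →
      Tendsto (fun n => ∫ x, f n x * φ x) U (𝓝 (∫ x, φ x ∂μ)) ∧
        |∫ x, φ x ∂μ| ≤ K * (eLpNorm φ q volume).toReal := by
  have hφL : ∀ φ : C_c(E N, ℝ), MemLp φ q volume := fun φ =>
    φ.continuous.memLp_of_hasCompactSupport φ.hasCompactSupport
  have hi : ∀ (φ : C_c(E N, ℝ)) n, Integrable (fun x => f n x * φ x) volume := fun φ n =>
    integrable_mul_of_holderConjugate (hf n) (hφL φ)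
  have hb : ∀ (φ : C_c(E N, ℝ)) n, |∫ x, f n x * φ x| ≤ K * (eLpNorm φ q volume).toReal :=
    fun φ n => (abs_integral_mul_le (hf n) (hφL φ)).trans
      (mul_le_mul_of_nonneg_right (ENNReal.toReal_le_of_le_ofReal hK0 (hK n))
        ENNReal.toReal_nonneg)
  choose L hL using fun φ : C_c(E N, ℝ) => exists_tendsto_ultrafilter U (hb φ)
  -- The limits form a positive linear functional, hence a regular measure by Riesz–Markov.
  let Λ : C_c(E N, ℝ) →ₚ[ℝ] ℝ :=
    { toFun := L
      map_add' := fun φ ψ => by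
        refine tendsto_nhds_unique (hL (φ + ψ)) (((hL φ).add (hL ψ)).congr fun n => ?_)
        rw [← integral_add (hi φ n) (hi ψ n)]
        congr 1
        funext x
        simp [mul_add]
      map_smul' := fun c φ => by
        refine tendsto_nhds_unique (hL (c • φ)) (((hL φ).const_mul c).congr fun n => ?_)
        rw [← integral_const_mul]
        congr 1
        funext x
        simp [mul_left_comm]
      monotone' := fun φ ψ h => le_of_tendsto_of_tendsto' (hL φ) (hL ψ) fun n =>
        integral_mono (hi φ n) (hi ψ n) fun x => mul_le_mul_of_nonneg_left (h x) (h0 n x) }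
  refine ⟨RealRMK.rieszMeasure Λ, inferInstance, fun φ hφ hφc => ?_⟩
  let ψ : C_c(E N, ℝ) := ⟨⟨φ, hφ⟩, hφc⟩
  have h1 : ∫ x, φ x ∂(RealRMK.rieszMeasure Λ) = L ψ := RealRMK.integral_rieszMeasure Λ ψ
  rw [h1]
  exact ⟨hL ψ, le_of_tendsto' (hL ψ).abs fun n => hb ψ n⟩

/-- Inner regularity reduces to compact subsets, and a Urysohn function between the compact set and
`V` is an admissible test. -/
theorem measure_isOpen_le_of_integral_le {q : ℝ≥0∞} {μ : Measure (E N)} [μ.Regular] {K : ℝ}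
    (hK0 : 0 ≤ K)
    (hK : ∀ φ : E N → ℝ, Continuous φ → HasCompactSupport φ →
      |∫ x, φ x ∂μ| ≤ K * (eLpNorm φ q volume).toReal) {V : Set (E N)} (hV : IsOpen V) :
    μ V ≤ ENNReal.ofReal K * eLpNorm (V.indicator fun _ => (1 : ℝ)) q volume := by
  rw [hV.measure_eq_iSup_isCompact μ]
  refine iSup₂_le fun S hSV => iSup_le fun hS => ?_
  obtain ⟨φ, hφ1, hφ0, hφc, hφ01⟩ := exists_continuous_one_zero_of_isCompact hS hV.isClosed_compl
    (Set.disjoint_compl_right_iff_subset.2 hSV)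
  have hφL : MemLp φ q volume := φ.continuous.memLp_of_hasCompactSupport hφc
  have hφi : Integrable φ μ := φ.continuous.integrable_of_hasCompactSupport hφc
  have hle : eLpNorm φ q volume ≤ eLpNorm (V.indicator fun _ => (1 : ℝ)) q volume := by
    refine eLpNorm_mono fun x => ?_
    by_cases hx : x ∈ V
    · rw [Set.indicator_of_mem hx, Real.norm_eq_abs, abs_of_nonneg (hφ01 x).1, norm_one]
      exact (hφ01 x).2
    · rw [hφ0 hx, Set.indicator_of_notMem hx]
      rfl
  calc μ S = ∫⁻ x, S.indicator 1 x ∂μ := by rw [lintegral_indicator_one hS.measurableSet]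
    _ ≤ ∫⁻ x, ENNReal.ofReal (φ x) ∂μ := by
        refine lintegral_mono fun x => ?_
        by_cases hx : x ∈ S
        · rw [Set.indicator_of_mem hx, hφ1 hx]
          simp
        · rw [Set.indicator_of_notMem hx]
          exact zero_le
    _ = ENNReal.ofReal (∫ x, φ x ∂μ) :=
        (ofReal_integral_eq_lintegral_ofReal hφi (ae_of_all _ fun x => (hφ01 x).1)).symm
    _ ≤ ENNReal.ofReal (K * (eLpNorm φ q volume).toReal) :=
        ENNReal.ofReal_le_ofReal ((le_abs_self _).trans (hK φ φ.continuous hφc))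
    _ = ENNReal.ofReal K * eLpNorm φ q volume := by
        rw [ENNReal.ofReal_mul hK0, ENNReal.ofReal_toReal hφL.2.ne]
    _ ≤ _ := by gcongr

/-- A null set lies in open sets of small volume, whose `μ`-measure is at most `K` times the volume
to the power `1 / q`. This needs `q < ∞`. -/
theorem absolutelyContinuous_of_integral_le {q : ℝ≥0∞} (hq0 : q ≠ 0) (hq : q ≠ ⊤)
    {μ : Measure (E N)} [μ.Regular] {K : ℝ} (hK0 : 0 ≤ K)
    (hK : ∀ φ : E N → ℝ, Continuous φ → HasCompactSupport φ →
      |∫ x, φ x ∂μ| ≤ K * (eLpNorm φ q volume).toReal) : μ ≪ volume := by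
  intro A hA
  have hqr : 0 < q.toReal := ENNReal.toReal_pos hq0 hq
  have key : ∀ ε : ℝ≥0∞, ε ≠ 0 → μ A ≤ ENNReal.ofReal K * ε ^ (1 / q.toReal) := by
    intro ε hε
    obtain ⟨V, hAV, hV, hVε⟩ := A.exists_isOpen_le_add (volume : Measure (E N)) hε
    rw [hA, zero_add] at hVε
    refine (measure_mono hAV).trans ((measure_isOpen_le_of_integral_le hK0 hK hV).trans ?_)
    rw [eLpNorm_indicator_const hV.measurableSet hq0 hq]
    simp only [enorm_one, one_mul]
    gcongr
  have hlim : Tendsto (fun ε : ℝ≥0∞ => ENNReal.ofReal K * ε ^ (1 / q.toReal)) (𝓝[>] 0) (𝓝 0) := by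
    have h1 : Tendsto (fun ε : ℝ≥0∞ => ε ^ (1 / q.toReal)) (𝓝[>] 0) (𝓝 0) := by
      have := (ENNReal.continuous_rpow_const (y := 1 / q.toReal)).tendsto 0
      rw [ENNReal.zero_rpow_of_pos (by positivity)] at this
      exact this.mono_left nhdsWithin_le_nhds
    simpa using ENNReal.Tendsto.const_mul h1 (Or.inr ENNReal.ofReal_ne_top)
  exact le_antisymm (ge_of_tendsto hlim (eventually_mem_nhdsWithin.mono fun ε hε =>
    key ε (ne_of_gt hε))) zero_le

/-- A measure that is bounded as a functional on `L^q` has a density in `L^p`. -/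
theorem exists_density_of_integral_le {p q : ℝ≥0∞} [p.HolderConjugate q] (hp : p ≠ ⊤)
    (hq : q ≠ ⊤) {μ : Measure (E N)} [μ.Regular] {K : ℝ} (hK0 : 0 ≤ K)
    (hK : ∀ φ : E N → ℝ, Continuous φ → HasCompactSupport φ →
      |∫ x, φ x ∂μ| ≤ K * (eLpNorm φ q volume).toReal) :
    ∃ w, MemLp w p volume ∧ ∀ φ : E N → ℝ, ∫ x, φ x ∂μ = ∫ x, w x * φ x := by
  have hpq : p.toReal.HolderConjugate q.toReal :=
    ENNReal.HolderConjugate.toReal_of_ne_top hp hq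
  have hp0 : p ≠ 0 := (ENNReal.HolderConjugate.pos p q).ne'
  have hq0 : q ≠ 0 := (ENNReal.HolderConjugate.pos q p).ne'
  have hq1 : 1 ≤ q := ENNReal.HolderConjugate.one_le q p
  have hac := absolutelyContinuous_of_integral_le hq0 hq hK0 hK
  set f := μ.rnDeriv volume with hf
  have hfm : Measurable f := Measure.measurable_rnDeriv _ _
  have main := lintegral_rpow_le_of_forall_lintegral_mul_le (μ := (volume : Measure (E N))) hpq
    hfm (C := ENNReal.ofReal K) ?_
  · refine ⟨fun x => (f x).toReal, ⟨hfm.ennreal_toReal.aestronglyMeasurable, ?_⟩, fun φ => ?_⟩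
    · rw [eLpNorm_lt_top_iff_lintegral_rpow_enorm_lt_top hp0 hp]
      refine lt_of_le_of_lt (lintegral_mono fun x => ?_) (main.trans_lt
        (ENNReal.rpow_lt_top_of_nonneg hpq.pos.le ENNReal.ofReal_ne_top))
      refine ENNReal.rpow_le_rpow ?_ hpq.pos.le
      rw [Real.enorm_eq_ofReal_abs, abs_of_nonneg ENNReal.toReal_nonneg]
      exact ENNReal.ofReal_toReal_le
    · simpa only [smul_eq_mul] using (integral_rnDeriv_smul hac (f := φ)).symm
  · intro g hg hgt
    have hgae : ∀ᵐ x ∂(volume : Measure (E N)), g x < ⊤ := by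
      filter_upwards [ae_lt_top (hg.pow_const q.toReal) hgt] with x hx
      exact (ENNReal.rpow_lt_top_iff_of_pos hpq.symm.pos).1 hx
    set γ : E N → ℝ := fun x => (g x).toReal with hγ
    have hγn : eLpNorm γ q volume = (∫⁻ x, g x ^ q.toReal) ^ (1 / q.toReal) := by
      rw [eLpNorm_eq_lintegral_rpow_enorm_toReal hq0 hq]
      congr 1
      refine lintegral_congr_ae ?_
      filter_upwards [hgae] with x hx
      rw [Real.enorm_eq_ofReal_abs, abs_of_nonneg ENNReal.toReal_nonneg,
        ENNReal.ofReal_toReal hx.ne]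
    have hγL : MemLp γ q volume := ⟨hg.ennreal_toReal.aestronglyMeasurable, by
      rw [hγn]; exact ENNReal.rpow_lt_top_of_nonneg (by positivity) hgt⟩
    -- Pairing the density with `g` is integration against `μ`. The bound, known for continuous
    -- compactly supported functions, passes to `g` by `L^q` approximation, an a.e. convergent
    -- subsequence and Fatou; absolute continuity turns a.e. convergence into `μ`-a.e. convergence.
    have e1 : ∫⁻ x, f x * g x = ∫⁻ x, g x ∂μ := lintegral_rnDeriv_mul hac hg.aemeasurable
    rw [e1, ← hγn]
    refine ENNReal.le_of_forall_pos_le_add fun ε hε _ => ?_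
    set η : ℝ := ε / (K + 1) with hη
    have hη0 : 0 < η := div_pos (by exact_mod_cast hε) (by positivity)
    have happ : ∀ n : ℕ, ∃ φ : E N → ℝ, HasCompactSupport φ ∧ Continuous φ ∧
        eLpNorm (φ - γ) q volume ≤ ENNReal.ofReal (η / (n + 1)) := by
      intro n
      obtain ⟨φ, h1, h2, h3, -⟩ := hγL.exists_hasCompactSupport_eLpNorm_sub_le hq
        (ε := ENNReal.ofReal (η / (n + 1))) (by simp; positivity)
      exact ⟨φ, h1, h3, by rwa [eLpNorm_sub_comm]⟩
    choose φ hφc hφ hφγ using happ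
    have hlim0 : Tendsto (fun n => eLpNorm (φ n - γ) q volume) atTop (𝓝 0) := by
      have : Tendsto (fun n : ℕ => ENNReal.ofReal (η / ((n : ℝ) + 1))) atTop (𝓝 0) := by
        rw [← ENNReal.ofReal_zero]
        refine ENNReal.tendsto_ofReal ?_
        simpa [div_eq_mul_inv] using
          (tendsto_one_div_add_atTop_nhds_zero_nat (𝕜 := ℝ)).const_mul η
      exact tendsto_of_tendsto_of_tendsto_of_le_of_le tendsto_const_nhds this
        (fun n => zero_le) hφγ
    obtain ⟨ns, -, hns⟩ := (tendstoInMeasure_of_tendsto_eLpNorm hq0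
      (fun n => (hφ n).aestronglyMeasurable) hγL.1 hlim0).exists_seq_tendsto_ae
    have hbound : ∀ n, ∫⁻ x, ENNReal.ofReal |φ n x| ∂μ
        ≤ ENNReal.ofReal K * eLpNorm γ q volume + ε := by
      intro n
      have habs : HasCompactSupport fun x => |φ n x| := (hφc n).comp_left abs_zero
      rw [← ofReal_integral_eq_lintegral_ofReal
        ((hφ n).abs.integrable_of_hasCompactSupport habs) (ae_of_all _ fun x => abs_nonneg _)]
      have h1 := hK _ (hφ n).abs habs
      have h2 : eLpNorm (fun x => |φ n x|) q volume = eLpNorm (φ n) q volume :=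
        eLpNorm_norm (φ n)
      have hφL : MemLp (φ n) q volume := (hφ n).memLp_of_hasCompactSupport (hφc n)
      have h3 : eLpNorm (φ n) q volume ≤ eLpNorm γ q volume + ENNReal.ofReal η := by
        have e : φ n = γ + (φ n - γ) := by simp
        conv_lhs => rw [e]
        refine (eLpNorm_add_le hγL.1 (hφL.1.sub hγL.1) hq1).trans ?_
        refine add_le_add le_rfl ((hφγ n).trans (ENNReal.ofReal_le_ofReal ?_))
        exact div_le_self hη0.le (by linarith [(Nat.cast_nonneg n : (0 : ℝ) ≤ n)])
      have h4 : ENNReal.ofReal K * ENNReal.ofReal η ≤ ε := by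
        rw [← ENNReal.ofReal_mul hK0, ← ENNReal.ofReal_coe_nnreal (p := ε)]
        refine ENNReal.ofReal_le_ofReal ?_
        rw [hη, mul_div_assoc', div_le_iff₀ (by positivity)]
        nlinarith [ε.2]
      calc _ ≤ ENNReal.ofReal (K * (eLpNorm (φ n) q volume).toReal) :=
            ENNReal.ofReal_le_ofReal ((le_abs_self _).trans (by rwa [h2] at h1))
        _ = ENNReal.ofReal K * eLpNorm (φ n) q volume := by
            rw [ENNReal.ofReal_mul hK0, ENNReal.ofReal_toReal hφL.2.ne]
        _ ≤ ENNReal.ofReal K * (eLpNorm γ q volume + ENNReal.ofReal η) := by gcongr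
        _ ≤ _ := by rw [mul_add]; gcongr
    calc ∫⁻ x, g x ∂μ = ∫⁻ x, liminf (fun k => ENNReal.ofReal |φ (ns k) x|) atTop ∂μ := by
          refine lintegral_congr_ae ?_
          filter_upwards [hac.ae_le hns, hac.ae_le hgae] with x hx hgx
          rw [(ENNReal.tendsto_ofReal hx.abs).liminf_eq, hγ, abs_of_nonneg ENNReal.toReal_nonneg,
            ENNReal.ofReal_toReal hgx.ne]
      _ ≤ liminf (fun k => ∫⁻ x, ENNReal.ofReal |φ (ns k) x| ∂μ) atTop :=
          lintegral_liminf_le fun k => (hφ (ns k)).abs.measurable.ennreal_ofReal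
      _ ≤ _ := (liminf_le_liminf (Eventually.of_forall fun k => hbound (ns k))).trans (by simp)

theorem eLpNorm_posPart_le {f : E N → ℝ} (p : ℝ≥0∞) :
    eLpNorm (fun x => max (f x) 0) p volume ≤ eLpNorm f p volume :=
  eLpNorm_mono fun x => by
    rw [Real.norm_eq_abs, Real.norm_eq_abs, abs_of_nonneg (le_max_right _ _)]
    exact max_le (le_abs_self _) (abs_nonneg _)

theorem memLp_posPart {f : E N → ℝ} {p : ℝ≥0∞} (hf : MemLp f p volume) :
    MemLp (fun x => max (f x) 0) p volume :=
  ⟨hf.1.sup aestronglyMeasurable_const, (eLpNorm_posPart_le p).trans_lt hf.2⟩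

/-- Weak limits along an ultrafilter of functions bounded in `L^p`, as differences of measures. -/
theorem exists_regular_tendsto_sub (U : Ultrafilter ℕ) {p q : ℝ≥0∞} [p.HolderConjugate q]
    {f : ℕ → E N → ℝ} (hf : ∀ n, MemLp (f n) p volume) {K : ℝ}
    (hK0 : 0 ≤ K) (hK : ∀ n, eLpNorm (f n) p volume ≤ ENNReal.ofReal K) :
    ∃ μ ν : Measure (E N), μ.Regular ∧ ν.Regular ∧
      ∀ φ : E N → ℝ, Continuous φ → HasCompactSupport φ →
      Tendsto (fun n => ∫ x, f n x * φ x) U (𝓝 ((∫ x, φ x ∂μ) - ∫ x, φ x ∂ν)) ∧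
        |∫ x, φ x ∂μ| ≤ K * (eLpNorm φ q volume).toReal ∧
        |∫ x, φ x ∂ν| ≤ K * (eLpNorm φ q volume).toReal := by
  have hfn : ∀ n, MemLp (fun x => -f n x) p volume := fun n => (hf n).neg
  -- Positive and negative parts are treated separately, since the Riesz–Markov step needs
  -- nonnegative functions.
  obtain ⟨μ, hμ, hμφ⟩ := exists_regular_tendsto U (q := q) (fun n => memLp_posPart (hf n))
    (fun n x => le_max_right _ _) hK0 (fun n => (eLpNorm_posPart_le p).trans (hK n))
  obtain ⟨ν, hν, hνφ⟩ := exists_regular_tendsto U (q := q) (fun n => memLp_posPart (hfn n))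
    (fun n x => le_max_right _ _) hK0 (fun n => (eLpNorm_posPart_le p).trans
      ((eLpNorm_neg (f n) p volume).trans_le (hK n)))
  refine ⟨μ, ν, hμ, hν, fun φ hφ hφc => ⟨?_, (hμφ φ hφ hφc).2, (hνφ φ hφ hφc).2⟩⟩
  have hφL : MemLp φ q volume := hφ.memLp_of_hasCompactSupport hφc
  refine ((hμφ φ hφ hφc).1.sub (hνφ φ hφ hφc).1).congr fun n => ?_
  rw [← integral_sub (integrable_mul_of_holderConjugate (memLp_posPart (hf n)) hφL)
    (integrable_mul_of_holderConjugate (memLp_posPart (hfn n)) hφL)]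
  congr 1
  funext x
  rw [← sub_mul]
  congr 1
  rcases le_total 0 (f n x) with h | h <;> simp [h]

/-- Weak sequential compactness in `L^p`, `1 < p < ∞`, along ultrafilters. -/
theorem exists_memLp_tendsto (U : Ultrafilter ℕ) {p q : ℝ≥0∞} [p.HolderConjugate q] (hp : p ≠ ⊤)
    (hq : q ≠ ⊤) {f : ℕ → E N → ℝ} (hf : ∀ n, MemLp (f n) p volume) {K : ℝ}
    (hK0 : 0 ≤ K) (hK : ∀ n, eLpNorm (f n) p volume ≤ ENNReal.ofReal K) :
    ∃ w, MemLp w p volume ∧ ∀ φ : E N → ℝ, Continuous φ → HasCompactSupport φ →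
      Tendsto (fun n => ∫ x, f n x * φ x) U (𝓝 (∫ x, w x * φ x)) := by
  obtain ⟨μ, ν, hμ, hν, h⟩ := exists_regular_tendsto_sub U (q := q) hf hK0 hK
  obtain ⟨w₁, hw₁, h₁⟩ := exists_density_of_integral_le (p := p) hp hq hK0
    fun φ hφ hφc => (h φ hφ hφc).2.1
  obtain ⟨w₂, hw₂, h₂⟩ := exists_density_of_integral_le (p := p) hp hq hK0
    fun φ hφ hφc => (h φ hφ hφc).2.2
  refine ⟨w₁ - w₂, hw₁.sub hw₂, fun φ hφ hφc => ?_⟩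
  have hφL : MemLp φ q volume := hφ.memLp_of_hasCompactSupport hφc
  have := (h φ hφ hφc).1
  rw [h₁, h₂, ← integral_sub (integrable_mul_of_holderConjugate hw₁ hφL)
    (integrable_mul_of_holderConjugate hw₂ hφL)] at this
  simpa only [← sub_mul, Pi.sub_apply] using this

/-- The measures `μ` and `ν` need not be mutually singular, so they may differ from the Jordan
parts; the comparison goes through the identity `j.posPart + ν = μ + j.negPart` of positive
measures. -/
theorem signedIntegral_sub {μ ν : Measure (E N)} [IsFiniteMeasure μ] [IsFiniteMeasure ν]
    {φ : E N → ℝ} (hφ : Continuous φ) (hφc : HasCompactSupport φ) :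
    signedIntegral φ (μ.toSignedMeasure - ν.toSignedMeasure)
      = (∫ x, φ x ∂μ) - ∫ x, φ x ∂ν := by
  set s := μ.toSignedMeasure - ν.toSignedMeasure with hs
  set j := s.toJordanDecomposition with hj
  have h1 : j.posPart.toSignedMeasure - j.negPart.toSignedMeasure = s :=
    SignedMeasure.toSignedMeasure_toJordanDecomposition s
  have h2 : (j.posPart + ν).toSignedMeasure = (μ + j.negPart).toSignedMeasure := by
    rw [Measure.toSignedMeasure_add, Measure.toSignedMeasure_add]
    rw [hs, sub_eq_sub_iff_add_eq_add] at h1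
    exact h1
  have h3 : j.posPart + ν = μ + j.negPart := Measure.toSignedMeasure_eq_toSignedMeasure_iff.1 h2
  have hi : ∀ (m : Measure (E N)) [IsFiniteMeasure m], Integrable φ m := fun m _ =>
    hφ.integrable_of_hasCompactSupport hφc
  have h4 : (∫ x, φ x ∂j.posPart) + ∫ x, φ x ∂ν = (∫ x, φ x ∂μ) + ∫ x, φ x ∂j.negPart := by
    rw [← integral_add_measure (hi _) (hi _), ← integral_add_measure (hi _) (hi _), h3]
  rw [signedIntegral]
  linarith

/-- Weak sequential compactness of `L^1` in the space of measures, along ultrafilters. -/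
theorem exists_signedMeasure_tendsto (U : Ultrafilter ℕ) {f : ℕ → E N → ℝ}
    (hf : ∀ n, MemLp (f n) 1 volume) {K : ℝ}
    (hK0 : 0 ≤ K) (hK : ∀ n, eLpNorm (f n) 1 volume ≤ ENNReal.ofReal K) :
    ∃ μ : SignedMeasure (E N), ∀ φ : E N → ℝ, Continuous φ → HasCompactSupport φ →
      Tendsto (fun n => ∫ x, f n x * φ x) U (𝓝 (signedIntegral φ μ)) := by
  obtain ⟨μ, ν, hμ, hν, h⟩ := exists_regular_tendsto_sub U (q := ⊤) hf hK0 hK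
  -- For `q = ∞` the indicator of the whole space has finite norm, so the total mass is finite.
  have hfin : ∀ m : Measure (E N), m.Regular → (∀ φ : E N → ℝ, Continuous φ →
      HasCompactSupport φ → |∫ x, φ x ∂m| ≤ K * (eLpNorm φ ⊤ volume).toReal) →
      IsFiniteMeasure m := fun m hm hmK => ⟨by
    refine (measure_isOpen_le_of_integral_le hK0 hmK isOpen_univ).trans_lt ?_
    refine ENNReal.mul_lt_top ENNReal.ofReal_lt_top ?_
    rw [Set.indicator_univ]
    exact (memLp_top_const (1 : ℝ)).2⟩
  have := hfin μ hμ fun φ hφ hφc => (h φ hφ hφc).2.1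
  have := hfin ν hν fun φ hφ hφc => (h φ hφ hφc).2.2
  refine ⟨μ.toSignedMeasure - ν.toSignedMeasure, fun φ hφ hφc => ?_⟩
  rw [signedIntegral_sub hφ hφc]
  exact (h φ hφ hφc).1

/-! ### The characterizations -/

theorem exists_hessBound {u : E N → ℝ} {q : ℝ≥0∞}
    (h : ∀ k l, ∃ c : ℝ, ∀ φ : E N → ℝ, IsTest φ →
      |∫ x, u x * pderiv k (pderiv l φ) x| ≤ c * (eLpNorm φ q volume).toReal) :
    ∃ C, 0 ≤ C ∧ HessBound u q C := by
  choose c hc using h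
  refine ⟨∑ k, ∑ l, |c k l|, by positivity, fun φ hφ k l => (hc k l φ hφ).trans ?_⟩
  refine mul_le_mul_of_nonneg_right ?_ ENNReal.toReal_nonneg
  calc c k l ≤ |c k l| := le_abs_self _
    _ ≤ ∑ l, |c k l| := Finset.single_le_sum (f := fun l => |c k l|)
        (fun _ _ => abs_nonneg _) (Finset.mem_univ l)
    _ ≤ _ := Finset.single_le_sum (f := fun k => ∑ l, |c k l|)
        (fun _ _ => Finset.sum_nonneg fun _ _ => abs_nonneg _) (Finset.mem_univ k)

theorem MemW.exists_hessBound {u : E N → ℝ} {p q : ℝ≥0∞} [p.HolderConjugate q]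
    (hu : MemW 2 p u) : ∃ C, 0 ≤ C ∧ HessBound u q C := by
  refine NonlocalHessian.exists_hessBound fun k l => ?_
  obtain ⟨v, hv, -, hv'⟩ := hu.2 k
  obtain ⟨w, hw, hwL⟩ := hv' l
  refine ⟨(eLpNorm w p volume).toReal, fun φ hφ => ?_⟩
  rw [hv.2.2 _ (hφ.pderiv l), hw.2.2 _ hφ, neg_neg]
  exact abs_integral_mul_le hwL (hφ.memLp q)

/-- By continuity the essential bound holds at every point. This matters because it is integrated
against measures that may be singular. -/
theorem abs_le_eLpNorm_top {φ : E N → ℝ} (hφ : IsTest φ) (x : E N) :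
    |φ x| ≤ (eLpNorm φ ⊤ volume).toReal := by
  set c := (eLpNorm φ ⊤ volume).toReal
  have hae : ∀ᵐ x ∂(volume : Measure (E N)), |φ x| ≤ c := by
    have hfin := (hφ.memLp ⊤).2.ne
    filter_upwards [enorm_ae_le_eLpNormEssSup φ volume] with x hx
    rw [← eLpNorm_exponent_top] at hx
    have := ENNReal.toReal_mono hfin hx
    rwa [toReal_enorm, Real.norm_eq_abs] at this
  by_contra hx
  have hopen : IsOpen {y | c < |φ y|} := isOpen_lt continuous_const hφ.continuous.abs
  refine (hopen.measure_pos volume ⟨x, not_le.1 hx⟩).ne' ?_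
  rw [ae_iff] at hae
  simpa only [not_le] using hae

theorem abs_signedIntegral_le (μ : SignedMeasure (E N)) {φ : E N → ℝ} (hφ : IsTest φ) :
    |signedIntegral φ μ| ≤ (μ.toJordanDecomposition.posPart.real Set.univ
      + μ.toJordanDecomposition.negPart.real Set.univ) * (eLpNorm φ ⊤ volume).toReal := by
  have h : ∀ m : Measure (E N), IsFiniteMeasure m →
      ‖∫ x, φ x ∂m‖ ≤ (eLpNorm φ ⊤ volume).toReal * m.real Set.univ := fun m _ =>
    norm_integral_le_of_norm_le_const (ae_of_all _ fun x => abs_le_eLpNorm_top hφ x)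
  rw [signedIntegral]
  refine (abs_sub _ _).trans ((add_le_add (h _ inferInstance) (h _ inferInstance)).trans ?_)
  apply le_of_eq
  ring

theorem MemBV2.exists_hessBound {u : E N → ℝ} (hu : MemBV2 u) :
    ∃ C, 0 ≤ C ∧ HessBound u ⊤ C := by
  refine NonlocalHessian.exists_hessBound fun k l => ?_
  obtain ⟨g, hg, hgBV⟩ := hu.2 k
  obtain ⟨μ, hμ⟩ := hgBV.2 l
  refine ⟨μ.toJordanDecomposition.posPart.real Set.univ
    + μ.toJordanDecomposition.negPart.real Set.univ, fun φ hφ => ?_⟩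
  rw [hg.2.2 _ (hφ.pderiv l), hμ _ hφ, neg_neg]
  exact abs_signedIntegral_le μ hφ

theorem HessBound.liminf_nlEnergy_lt_top {ρ : ℕ → E N → ℝ} (hρ : IsRadialMollifierSeq ρ) {p : ℝ}
    (hp : 1 ≤ p) {q : ℝ≥0∞} [(ENNReal.ofReal p).HolderConjugate q] {u : E N → ℝ} {C : ℝ}
    (hC : 0 ≤ C) (hB : HessBound u q C) (hu : MemLp u (ENNReal.ofReal p) volume) :
    liminf (fun n => nlEnergy (ρ n) p u) atTop < ⊤ := by
  refine lt_of_le_of_lt (liminf_le_liminf (Eventually.of_forall fun n =>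
    hB.nlEnergy_le (hρ.integral_eq_one n) (hρ.nonneg n) hp hC hu)) ?_
  rw [liminf_const]
  exact ENNReal.rpow_lt_top_of_nonneg (by linarith) (by finiteness)

theorem eLpNorm_apply_le_of_lintegral_frob_lt {v : E N → Matrix (Fin N) (Fin N) ℝ} {p : ℝ}
    (hp : 0 < p) {c : ℝ≥0∞} (hv : ∫⁻ x, ENNReal.ofReal (frob (v x) ^ p) < c) (i j : Fin N) :
    eLpNorm (fun x => v x i j) (ENNReal.ofReal p) volume ≤ c ^ (1 / p) := by
  rw [lintegral_frob_rpow_eq v hp] at hv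
  have h1 : eLpNorm (fun x => v x i j) (ENNReal.ofReal p) volume
      ≤ eLpNorm (fun x => frob (v x)) (ENNReal.ofReal p) volume :=
    eLpNorm_mono_real fun x => abs_le_frob (v x) i j
  refine h1.trans ?_
  have := ENNReal.rpow_le_rpow hv.le (by positivity : 0 ≤ 1 / p)
  rwa [← ENNReal.rpow_mul, mul_one_div_cancel hp.ne', ENNReal.rpow_one] at this

/-- Along a suitable ultrafilter the non-local Hessians of bounded energy converge to the
distributional Hessian. -/
theorem exists_tendsto_of_liminf_lt_top (hN : 1 ≤ N) {ρ : ℕ → E N → ℝ}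
    (hρ : IsRadialMollifierSeq ρ) {p : ℝ} (hp : 1 ≤ p) {q : ℝ≥0∞}
    [(ENNReal.ofReal p).HolderConjugate q] {u : E N → ℝ}
    (hu : MemLp u (ENNReal.ofReal p) volume)
    (hlim : liminf (fun n => nlEnergy (ρ n) p u) atTop < ⊤) :
    ∃ (U : Ultrafilter ℕ) (K : ℝ) (v : ℕ → E N → Matrix (Fin N) (Fin N) ℝ), 0 ≤ K ∧
      (∀ n i j, MemLp (fun x => v n x i j) (ENNReal.ofReal p) volume ∧
        eLpNorm (fun x => v n x i j) (ENNReal.ofReal p) volume ≤ ENNReal.ofReal K) ∧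
      ∀ φ : E N → ℝ, IsTest φ → ∀ i j, Tendsto (fun n => ∫ x, v n x i j * φ x) U
        (𝓝 (∫ x, u x * pderiv i (pderiv j φ) x)) := by
  have hp0 : 0 < p := by linarith
  have hul := locallyIntegrable_of_memLp (q := q) hu
  obtain ⟨c, hc, hct⟩ := exists_between hlim
  set S : Set ℕ := {n | nlEnergy (ρ n) p u < c} with hS
  -- Energies below `c` occur infinitely often, so some ultrafilter finer than `atTop` concentrates
  -- on those indices.
  have hfreq : ∃ᶠ n in atTop, n ∈ S := frequently_lt_of_liminf_lt (by isBoundedDefault) hc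
  have : NeBot (atTop ⊓ 𝓟 S) := frequently_mem_iff_neBot.1 hfreq
  set U : Ultrafilter ℕ := Ultrafilter.of (atTop ⊓ 𝓟 S) with hU
  have hUle : (U : Filter ℕ) ≤ atTop ⊓ 𝓟 S := Ultrafilter.of_le _
  have hcp : c ^ (1 / p) ≠ ⊤ := ENNReal.rpow_ne_top_of_nonneg (by positivity) hct.ne
  set K := (c ^ (1 / p)).toReal with hK
  have hv : ∀ n, ∃ v : E N → Matrix (Fin N) (Fin N) ℝ, (n ∈ S → IsDistNlHessian (ρ n) u v) ∧
      ∀ i j, MemLp (fun x => v x i j) (ENNReal.ofReal p) volume ∧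
        eLpNorm (fun x => v x i j) (ENNReal.ofReal p) volume ≤ ENNReal.ofReal K := by
    intro n
    by_cases hn : n ∈ S
    · have hn' : nlEnergy (ρ n) p u < c := hn
      simp only [nlEnergy, iInf_lt_iff] at hn'
      obtain ⟨v, hv, hvc⟩ := hn'
      have hle := eLpNorm_apply_le_of_lintegral_frob_lt hp0 hvc
      refine ⟨v, fun _ => hv, fun i j => ⟨⟨(hv i j).1.aestronglyMeasurable,
        (hle i j).trans_lt hcp.lt_top⟩, ?_⟩⟩
      rw [hK, ENNReal.ofReal_toReal hcp]
      exact hle i j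
    -- Off `S` the value is irrelevant along the ultrafilter; zero keeps the uniform bounds valid
    -- for all `n`.
    · refine ⟨0, fun h => absurd h hn, fun i j => ?_⟩
      have e : (fun x : E N => (0 : E N → Matrix (Fin N) (Fin N) ℝ) x i j) = 0 := rfl
      rw [e]
      exact ⟨MemLp.zero, by simp⟩
  choose v hvS hvL using hv
  refine ⟨U, K, v, ENNReal.toReal_nonneg, hvL, fun φ hφ i j => ?_⟩
  obtain ⟨M, -, -, hM⟩ := exists_integral_abs_mul_secondDiff_le (q := q) hφ hu
  have h1 := tendsto_nlHessian_zero hN hρ (corr_contDiff hul hφ) hM i j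
  rw [pderiv_corr hul hφ, pderiv_corr hul (hφ.pderiv j), corr_zero] at h1
  refine (h1.mono_left (hUle.trans inf_le_left)).congr' ?_
  have hSU : ∀ᶠ n in (U : Filter ℕ), n ∈ S :=
    hUle.trans inf_le_right (mem_principal_self S)
  filter_upwards [hSU] with n hn
  rw [← (hvS n hn i j).2 φ hφ, distNlHessian_eq (q := q)
    (integrable_of_integral_eq_one (hρ.integral_eq_one n)) (hρ.nonneg n) hu hφ]

/-- Hölder's inequality holds for each `n` with the same constant and passes to the limit. -/
theorem hessBound_of_tendsto {u : E N → ℝ} {p q : ℝ≥0∞} [p.HolderConjugate q]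
    {U : Ultrafilter ℕ} {K : ℝ} {v : ℕ → E N → Matrix (Fin N) (Fin N) ℝ} (hK : 0 ≤ K)
    (hv : ∀ n i j, MemLp (fun x => v n x i j) p volume ∧
        eLpNorm (fun x => v n x i j) p volume ≤ ENNReal.ofReal K)
    (hlim : ∀ φ : E N → ℝ, IsTest φ → ∀ i j, Tendsto (fun n => ∫ x, v n x i j * φ x) U
        (𝓝 (∫ x, u x * pderiv i (pderiv j φ) x))) : HessBound u q K := fun φ hφ k l =>
  le_of_tendsto' (hlim φ hφ k l).abs fun n =>
    (abs_integral_mul_le (hv n k l).1 (hφ.memLp q)).trans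
      (mul_le_mul_of_nonneg_right (ENNReal.toReal_le_of_le_ofReal hK (hv n k l).2)
        ENNReal.toReal_nonneg)

theorem memW_two_of_liminf_lt_top (hN : 1 ≤ N) {ρ : ℕ → E N → ℝ}
    (hρ : IsRadialMollifierSeq ρ) {p : ℝ} (hp : 1 < p) {u : E N → ℝ}
    (hu : MemLp u (ENNReal.ofReal p) volume)
    (hlim : liminf (fun n => nlEnergy (ρ n) p u) atTop < ⊤) : MemW 2 (ENNReal.ofReal p) u := by
  have hpq := (Real.HolderConjugate.conjExponent hp).ennrealOfReal
  set q := ENNReal.ofReal (Real.conjExponent p) with hq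
  obtain ⟨U, K, v, hK, hv, hvlim⟩ :=
    exists_tendsto_of_liminf_lt_top (q := q) hN hρ hp.le hu hlim
  have hB : HessBound u q K := hessBound_of_tendsto hK hv hvlim
  refine ⟨hu, fun i => ?_⟩
  obtain ⟨g, hg, hgL⟩ := hB.exists_hasWeakPartial (by simp) hK hu i
  refine ⟨g, hg, hgL, fun j => ?_⟩
  obtain ⟨w, hw, hwlim⟩ := exists_memLp_tendsto U (q := q) (by simp) (by simp [hq])
    (fun n => (hv n i j).1) hK (fun n => (hv n i j).2)
  refine ⟨w, ⟨locallyIntegrable_of_memLp (q := q) hgL, locallyIntegrable_of_memLp (q := q) hw,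
    fun φ hφ => ?_⟩, hw⟩
  rw [tendsto_nhds_unique (hwlim φ hφ.continuous hφ.2) (hvlim φ hφ i j),
    hg.2.2 _ (hφ.pderiv j), neg_neg]

/-- For `p = 1` the gradient still lies in `L^1`, as a norm limit of difference quotients; only the
second derivatives degrade to measures. -/
theorem memBV2_of_liminf_lt_top (hN : 1 ≤ N) {ρ : ℕ → E N → ℝ}
    (hρ : IsRadialMollifierSeq ρ) {u : E N → ℝ} (hu : MemLp u 1 volume)
    (hlim : liminf (fun n => nlEnergy (ρ n) 1 u) atTop < ⊤) : MemBV2 u := by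
  have hpq : (ENNReal.ofReal 1).HolderConjugate ⊤ := by
    rw [ENNReal.ofReal_one]; infer_instance
  obtain ⟨U, K, v, hK, hv, hvlim⟩ :=
    exists_tendsto_of_liminf_lt_top (q := ⊤) hN hρ le_rfl (by rwa [ENNReal.ofReal_one]) hlim
  have hB : HessBound u ⊤ K := hessBound_of_tendsto hK hv hvlim
  rw [ENNReal.ofReal_one] at hv
  have hex := hB.exists_hasWeakPartial (by simp) hK hu
  refine ⟨⟨hu, hex⟩, fun i => ?_⟩
  obtain ⟨g, hg, hgL⟩ := hex i
  refine ⟨g, hg, hgL, fun j => ?_⟩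
  obtain ⟨μ, hμ⟩ := exists_signedMeasure_tendsto U (fun n => (hv n i j).1) hK
    (fun n => (hv n i j).2)
  refine ⟨μ, fun φ hφ => ?_⟩
  rw [tendsto_nhds_unique (hμ φ hφ.continuous hφ.2) (hvlim φ hφ i j),
    hg.2.2 _ (hφ.pderiv j), neg_neg]

end NonlocalHessian

/-! ### The two equivalences -/

theorem theorem1p7 (N : ℕ) (hN : 1 ≤ N) (ρ : ℕ → EuclideanSpace ℝ (Fin N) → ℝ)
    (hρ : NonlocalHessian.IsRadialMollifierSeq ρ) :
    (∀ p : ℝ, 1 < p → ∀ u : EuclideanSpace ℝ (Fin N) → ℝ,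
      MemLp u (ENNReal.ofReal p) volume →
        (NonlocalHessian.MemW 2 (ENNReal.ofReal p) u ↔
          liminf (fun n => NonlocalHessian.nlEnergy (ρ n) p u) atTop < ⊤)) ∧
    (∀ u : EuclideanSpace ℝ (Fin N) → ℝ,
      MemLp u 1 volume →
        (NonlocalHessian.MemBV2 u ↔
          liminf (fun n => NonlocalHessian.nlEnergy (ρ n) 1 u) atTop < ⊤)) := by
  refine ⟨fun p hp u hu => ⟨fun h => ?_,
    NonlocalHessian.memW_two_of_liminf_lt_top hN hρ hp hu⟩,
    fun u hu => ⟨fun h => ?_, NonlocalHessian.memBV2_of_liminf_lt_top hN hρ hu⟩⟩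
  · have hpq := (Real.HolderConjugate.conjExponent hp).ennrealOfReal
    obtain ⟨C, hC, hB⟩ := NonlocalHessian.MemW.exists_hessBound
      (q := ENNReal.ofReal (Real.conjExponent p)) h
    exact hB.liminf_nlEnergy_lt_top hρ hp.le hC hu
  · have hpq : (ENNReal.ofReal 1).HolderConjugate ⊤ := by
      rw [ENNReal.ofReal_one]; infer_instance
    obtain ⟨C, hC, hB⟩ := NonlocalHessian.MemBV2.exists_hessBound h
    exact hB.liminf_nlEnergy_lt_top hρ le_rfl hC (by rwa [ENNReal.ofReal_one])
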